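/- A circuit over the gate set $\{CCX, CX, X\}$ on a finite set of qubits is a finite sequence of layers, where each layer consists of $X$, $CX$ and $CCX$ gates acting on pairwise disjoint sets of qubits; its gate count is the total number of gates and its depth is the number of layers. The $n$-bit quantum--quantum comparator is the unitary on $2n+1$ qubits given by $$|\boldsymbol a\rangle|\boldsymbol b\rangle|z\rangle \mapsto |\boldsymbol a\rangle|\boldsymbol b\rangle|z\oplus(a<b)\rangle,\qquad \boldsymbol a,\boldsymbol b\in\{0,1\}^n,\ z\in\{0,1\},$$ where $a,b$ are the integers with binary expansions $\boldsymbol a,\boldsymbol b$ and $(a<b)$ is $1$ if $a<b$ and $0$ otherwise. The $k$-controlled comparator acts on $k$ further control qubits, whose basis states it preserves; it applies the comparator if all the control qubits are in state $|1\rangle$, and the identity if the control qubits are in any other basis state. Theorem. For all integers $k\ge 1$ and $n>1$, the $k$-controlled $n$-bit quantum--quantum comparator can be implemented exactly over $\{CCX, CX, X\}$ with $\Theta(k+n)$ gates and $\Theta(\log(kn))$ depth (both achieved by the same circuit), without any ancilla qubits, and this is asymptotically optimal. That is, there are absolute constants $c,C>0$ such that for all integers $k\ge1$ and $n>1$: 1.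 some circuit over $\{CCX, CX, X\}$ on exactly the $k+2n+1$ qubits of the $k$-controlled $n$-bit comparator implements it, with at most $C\,(k+n)$ gates and depth at most $C\log(kn)$; 2. every circuit over $\{CCX, CX, X\}$ on these $k+2n+1$ qubits that implements the $k$-controlled $n$-bit comparator has at least $c\,(k+n)$ gates and depth at least $c\log(kn)$. -/

import Mathlib

namespace QuantumCircuit

/-- Operators on a register of qubits labelled by `Q`, as matrices in the computational basis,
whose basis states `|x⟩` are indexed by the bit assignments `x : Q → Bool`. -/
abbrev Operator (Q : Type) : Type := Matrix (Q → Bool) (Q → Bool) ℂ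

/-- The operator determined linearly by `|x⟩ ↦ |f x⟩`. -/
def basisOperator {Q : Type} [Fintype Q] (f : (Q → Bool) → (Q → Bool)) : Operator Q :=
  fun y x => if y = f x then 1 else 0

/-- A gate of the set `{CCX, CX, X}` placed on qubits of `Q`: an `X` on the qubit `target`,
controlled by zero (`X`), one (`CX`) or two (`CCX`) other qubits. -/
structure Gate (Q : Type) where
  controls : Finset Q
  target : Q
  target_notMem : target ∉ controls
  card_controls : controls.card ≤ 2

namespace Gate

variable {Q : Type} [DecidableEq Q]

/-- The qubits on which the gate acts. -/
def support (g : Gate Q) : Finset Q := insert g.target g.controls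

/-- Action on basis states: the target bit `t` becomes `t ⊕ ⋀ c`, over the controls `c`. -/
def act (g : Gate Q) (x : Q → Bool) : Q → Bool :=
  Function.update x g.target (xor (x g.target) (decide (∀ c ∈ g.controls, x c = true)))

/-- The unitary of the gate on the whole register. -/
def operator [Fintype Q] (g : Gate Q) : Operator Q := basisOperator g.act

end Gate

/-- A circuit over `{CCX, CX, X}` on exactly the qubits `Q`: a sequence of layers, the first
one applied first, where the gates of one layer act on pairwise disjoint sets of qubits. -/
structure Circuit (Q : Type) [DecidableEq Q] where
  layers : List (List (Gate Q))
  disjoint : ∀ l ∈ layers, l.Pairwise (fun g h => Disjoint g.support h.support)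

namespace Circuit

variable {Q : Type} [DecidableEq Q]

/-- The gates of the circuit in order of application. -/
def gates (T : Circuit Q) : List (Gate Q) := T.layers.flatten

/-- The number of gates. -/
def gateCount (T : Circuit Q) : ℕ := T.gates.length

/-- The number of layers of gates executed in parallel. -/
def depth (T : Circuit Q) : ℕ := T.layers.length

/-- The operator of the circuit: for gates `g₁, …, g_m` in order of application, the product
`U_{g_m} ⋯ U_{g₁}`. -/
def operator [Fintype Q] (T : Circuit Q) : Operator Q :=
  T.gates.foldr (fun g U => U * g.operator) 1

/-- The circuit implements `U` exactly on its own qubits, hence without any ancilla. -/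
def Implements [Fintype Q] (T : Circuit Q) (U : Operator Q) : Prop := T.operator = U

end Circuit

/-- The operator `C^k U`, with `k` further control qubits `Sum.inl i`: it leaves the control
bits unchanged, and acts on the other qubits as `U` if all the control bits are `1` and as the
identity otherwise. -/
def controlled {Q : Type} [Fintype Q] [DecidableEq Q] (k : ℕ) (U : Operator Q) :
    Operator (Fin k ⊕ Q) :=
  fun y x =>
    if y ∘ Sum.inl = x ∘ Sum.inl then
      (if ∀ i : Fin k, x (Sum.inl i) = true then U else (1 : Operator Q))
        (y ∘ Sum.inr) (x ∘ Sum.inr)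
    else 0

/-- The qubits of the `n`-bit comparator: two `n`-qubit registers (bit `0` is the least
significant one) and one output qubit. -/
inductive ComparatorQubit (n : ℕ) : Type
  | a (i : Fin n)
  | b (i : Fin n)
  | z
  deriving DecidableEq, Fintype

/-- The quantum–quantum comparator `|a⟩|b⟩|z⟩ ↦ |a⟩|b⟩|z ⊕ (a < b)⟩` over `n`-bit registers. -/
def comparator (n : ℕ) : Operator (ComparatorQubit n) :=
  basisOperator fun x =>
    Function.update x .z
      (xor (x .z)
        (decide (Nat.ofBits (fun i => x (.a i)) < Nat.ofBits (fun i => x (.b i)))))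

end QuantumCircuit

/-! Lower bounds. The bit added to the output qubit is sensitive to each of the other `k + 2n`
qubits (`comparatorBit_sensitive`). A gate touches at most three qubits, so the gates must be at
least a third as many as these qubits. The backward light cone of one qubit grows at most threefold
per layer (`exists_dependency`), so the depth is at least logarithmic in their number.
`Circuit.lower_bound` combines both arguments.

Upper bounds. Once each `a i` is replaced by the equality bit of `a i` and `b i`, the comparison is
the bit `b i` at the most significant position whose equality bit is `0`. This is the selection
`sel` of a list of items (`sel_reverse_finRange`). Adjacent items merge into one, so a balanced tree
evaluates `sel` in logarithmic depth if zero qubits are available (`exists_impl_tree`).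

Without ancillas, these qubits come from the input. If all selecting bits of a block are `1`, they
are usable as known ones for the later items; if not, the selection is already decided and the later
items are irrelevant (`sel_of_not_forall`). Each pair of ones handles four items and leaves four
selecting bits, so the supply doubles at each stage and logarithmically many stages suffice
(`exists_impl_stage`, `exists_impl_sel`). The tree on one block runs in parallel with the later
stages. The first two ones are qubits that also act as controls: when they are not both `1`, nothing
is toggled anyway (`impl_toggle_sel`).

A control on a qubit in an unknown state is removed by a commutator (`Impl.toggle_and`). A
conjunction is the XOR of two selections with different default values, which gives the multiply
controlled `X` (`impl_toggle_all`). The controlled comparator is an XOR of three such toggles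
(`impl_toggle_all_and_sel`). -/

namespace QuantumCircuit

/-! ### Gate sequences acting on basis states, and composition of layered circuits -/

section

variable {Q : Type}

/-- Two sequences of layers executed side by side. -/
def zipLayers : List (List (Gate Q)) → List (List (Gate Q)) → List (List (Gate Q))
  | [], ms => ms
  | l :: ls, [] => l :: ls
  | l :: ls, m :: ms => (l ++ m) :: zipLayers ls ms

theorem exists_of_mem_zipLayers {l : List (Gate Q)} : ∀ {ls ms : List (List (Gate Q))},
    l ∈ zipLayers ls ms → ∃ l₁ l₂, (l₁ = [] ∨ l₁ ∈ ls) ∧ (l₂ = [] ∨ l₂ ∈ ms) ∧ l = l₁ ++ l₂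
  | [], ms, h => ⟨[], l, by simp, Or.inr h, rfl⟩
  | a :: ls, [], h => ⟨l, [], Or.inr h, by simp, by simp⟩
  | a :: ls, m :: ms, h => by
    rcases List.mem_cons.mp h with rfl | h
    · exact ⟨a, m, by simp, by simp, rfl⟩
    · obtain ⟨l₁, l₂, h1, h2, h3⟩ := exists_of_mem_zipLayers h
      exact ⟨l₁, l₂, h1.imp_right (List.mem_cons_of_mem _),
        h2.imp_right (List.mem_cons_of_mem _), h3⟩

theorem length_zipLayers : ∀ ls ms : List (List (Gate Q)),
    (zipLayers ls ms).length = max ls.length ms.length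
  | [], ms => by simp [zipLayers]
  | l :: ls, [] => by simp [zipLayers]
  | l :: ls, m :: ms => by simp [zipLayers, length_zipLayers ls ms]

theorem length_flatten_zipLayers : ∀ ls ms : List (List (Gate Q)),
    (zipLayers ls ms).flatten.length = ls.flatten.length + ms.flatten.length
  | [], ms => by simp [zipLayers]
  | l :: ls, [] => by simp [zipLayers]
  | l :: ls, m :: ms => by
    have := length_flatten_zipLayers ls ms
    simp only [zipLayers, List.flatten_cons, List.length_append] at this ⊢
    omega

variable [DecidableEq Q]

/-- The action of a sequence of gates on basis states, first gate first. -/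
def run (gs : List (Gate Q)) (x : Q → Bool) : Q → Bool :=
  gs.foldl (fun y g => g.act y) x

@[simp] theorem run_nil (x : Q → Bool) : run [] x = x := rfl

@[simp] theorem run_cons (g : Gate Q) (gs : List (Gate Q)) (x : Q → Bool) :
    run (g :: gs) x = run gs (g.act x) := rfl

theorem run_append (gs hs : List (Gate Q)) (x : Q → Bool) :
    run (gs ++ hs) x = run hs (run gs x) := by
  simp [run]

namespace Gate

theorem act_of_ne (g : Gate Q) (x : Q → Bool) {q : Q} (h : q ≠ g.target) : g.act x q = x q := by
  simp [act, h]

theorem target_mem_support (g : Gate Q) : g.target ∈ g.support := by simp [support]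

theorem act_of_notMem (g : Gate Q) (x : Q → Bool) {q : Q} (h : q ∉ g.support) :
    g.act x q = x q :=
  g.act_of_ne x fun e => h (e ▸ g.target_mem_support)

theorem act_act (g : Gate Q) (x : Q → Bool) : g.act (g.act x) = x := by
  have h : ∀ c ∈ g.controls, g.act x c = x c := fun c hc =>
    g.act_of_ne x fun e => g.target_notMem (e ▸ hc)
  have h' : (∀ c ∈ g.controls, g.act x c = true) ↔ ∀ c ∈ g.controls, x c = true :=
    forall₂_congr fun c hc => by rw [h c hc]
  funext q
  by_cases hq : q = g.target
  · subst hq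
    have h'' : decide (∀ c ∈ g.controls, g.act x c = true) =
        decide (∀ c ∈ g.controls, x c = true) := decide_eq_decide.mpr h'
    rw [act, Function.update_self, h'', act, Function.update_self]
    simp
  · rw [act_of_ne _ _ hq, act_of_ne _ _ hq]

theorem act_congr (g : Gate Q) {x y : Q → Bool} (h : ∀ q ∈ g.support, x q = y q)
    {q : Q} (hq : x q = y q) : g.act x q = g.act y q := by
  by_cases e : q = g.target
  · subst e
    have h' : (∀ c ∈ g.controls, x c = true) ↔ ∀ c ∈ g.controls, y c = true :=
      forall₂_congr fun c hc => by rw [h c (by simp [support, hc])]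
    simp only [act, Function.update_self, hq, decide_eq_decide.mpr h']
  · rw [act_of_ne _ _ e, act_of_ne _ _ e, hq]

theorem card_support (g : Gate Q) : g.support.card ≤ 3 := by
  have := Finset.card_insert_le g.target g.controls
  have := g.card_controls
  simp only [support]; omega

end Gate

theorem run_of_notMem (gs : List (Gate Q)) (x : Q → Bool) {q : Q}
    (h : ∀ g ∈ gs, q ∉ g.support) : run gs x q = x q := by
  induction gs generalizing x with
  | nil => rfl
  | cons g gs ih =>
    rw [run_cons, ih _ fun g hg => h g (by simp [hg]), g.act_of_notMem x (h g (by simp))]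

/-- The bit `q` may lie outside `S`: each gate leaves it alone or toggles it by an amount that
depends only on bits in `S`. -/
theorem run_congr (gs : List (Gate Q)) (S : Set Q) (hS : ∀ g ∈ gs, ∀ q ∈ g.support, q ∈ S)
    {x y : Q → Bool} (h : ∀ q ∈ S, x q = y q) {q : Q} (hq : x q = y q) :
    run gs x q = run gs y q := by
  induction gs generalizing x y with
  | nil => exact hq
  | cons g gs ih =>
    have hg : ∀ q ∈ g.support, x q = y q := fun q hq => h q (hS g (by simp) q hq)
    exact ih (fun g' hg' => hS g' (by simp [hg'])) (fun q hq => g.act_congr hg (h q hq))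
      (g.act_congr hg hq)

theorem run_reverse_run (gs : List (Gate Q)) (x : Q → Bool) : run gs.reverse (run gs x) = x := by
  induction gs generalizing x with
  | nil => rfl
  | cons g gs ih => rw [List.reverse_cons, run_append, run_cons g gs, ih]; exact g.act_act x

theorem run_run_reverse (gs : List (Gate Q)) (x : Q → Bool) : run gs (run gs.reverse x) = x := by
  simpa using run_reverse_run gs.reverse x

theorem run_comm (gs hs : List (Gate Q))
    (h : ∀ g ∈ gs, ∀ g' ∈ hs, Disjoint g.support g'.support) (x : Q → Bool) :
    run gs (run hs x) = run hs (run gs x) := by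
  funext q
  by_cases hq : ∃ g ∈ gs, q ∈ g.support
  · obtain ⟨g, hg, hq⟩ := hq
    have h1 : ∀ q, (∃ g ∈ gs, q ∈ g.support) → ∀ g' ∈ hs, q ∉ g'.support :=
      fun q ⟨g, hg, hq⟩ g' hg' hq' => Finset.disjoint_left.mp (h g hg g' hg') hq hq'
    rw [run_of_notMem hs _ (h1 q ⟨g, hg, hq⟩)]
    exact run_congr gs {q | ∃ g ∈ gs, q ∈ g.support} (fun g hg q hq => ⟨g, hg, hq⟩)
      (fun q hq => run_of_notMem hs x (h1 q hq)) (run_of_notMem hs x (h1 q ⟨g, hg, hq⟩))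
  · push Not at hq
    rw [run_of_notMem gs _ hq]
    refine run_congr hs {q | ∃ g ∈ hs, q ∈ g.support} (fun g hg q hq => ⟨g, hg, hq⟩) ?_ ?_
    · rintro p ⟨g', hg', hp⟩
      exact (run_of_notMem gs x fun g hg hp' =>
        Finset.disjoint_left.mp (h g hg g' hg') hp' hp).symm
    · exact (run_of_notMem gs x hq).symm

/-- The map `f` on basis states is implemented by layers of gates acting on qubits of `S`, with
at most `s` gates in at most `d` layers. -/
def Impl (S : List Q) (f : (Q → Bool) → (Q → Bool)) (s d : ℕ) : Prop :=
  ∃ ls : List (List (Gate Q)),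
    (∀ l ∈ ls, l.Pairwise fun g h => Disjoint g.support h.support) ∧
    (∀ l ∈ ls, ∀ g ∈ l, ∀ q ∈ g.support, q ∈ S) ∧
    ls.flatten.length ≤ s ∧ ls.length ≤ d ∧ ∀ x, run ls.flatten x = f x

namespace Impl

variable {S T : List Q} {f g : (Q → Bool) → (Q → Bool)} {s s' d d' : ℕ}

theorem mono (h : Impl S f s d) (hS : S ⊆ T) (hs : s ≤ s') (hd : d ≤ d') : Impl T f s' d' := by
  obtain ⟨ls, h1, h2, h3, h4, h5⟩ := h
  exact ⟨ls, h1, fun l hl g hg q hq => hS (h2 l hl g hg q hq), h3.trans hs, h4.trans hd, h5⟩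

theorem refl (S : List Q) : Impl S id 0 0 := ⟨[], by simp⟩

theorem congr (h : Impl S f s d) (e : ∀ x, f x = g x) : Impl S g s d := by
  rwa [← funext e]

theorem comp (hf : Impl S f s d) (hg : Impl S g s' d') :
    Impl S (fun x => g (f x)) (s + s') (d + d') := by
  obtain ⟨ls, h1, h2, h3, h4, h5⟩ := hf
  obtain ⟨ms, k1, k2, k3, k4, k5⟩ := hg
  refine ⟨ls ++ ms, ?_, ?_, ?_, ?_, fun x => ?_⟩
  · intro l hl
    exact (List.mem_append.mp hl).elim (h1 l) (k1 l)
  · intro l hl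
    exact (List.mem_append.mp hl).elim (h2 l) (k2 l)
  · rw [List.flatten_append, List.length_append]; omega
  · rw [List.length_append]; omega
  · rw [List.flatten_append, run_append, h5, k5]

theorem of_notMem (h : Impl S f s d) {q : Q} (hq : q ∉ S) (x : Q → Bool) : f x q = x q := by
  obtain ⟨ls, -, h2, -, -, h5⟩ := h
  rw [← h5]
  refine run_of_notMem _ _ fun g hg hq' => hq ?_
  obtain ⟨l, hl, hg⟩ := List.mem_flatten.mp hg
  exact h2 l hl g hg q hq'

theorem agree (h : Impl S f s d) {x y : Q → Bool} (hxy : ∀ q ∈ S, x q = y q) {q : Q}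
    (hq : x q = y q) : f x q = f y q := by
  obtain ⟨ls, -, h2, -, -, h5⟩ := h
  rw [← h5, ← h5]
  refine run_congr _ {q | q ∈ S} (fun g hg q hq => ?_) hxy hq
  obtain ⟨l, hl, hg⟩ := List.mem_flatten.mp hg
  exact h2 l hl g hg q hq

/-- Every gate is an involution, so the reversed circuit uncomputes `f` at the same cost. -/
theorem exists_inverse (h : Impl S f s d) :
    ∃ f', Impl S f' s d ∧ (∀ x, f' (f x) = x) ∧ ∀ x, f (f' x) = x := by
  obtain ⟨ls, h1, h2, h3, h4, h5⟩ := h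
  have e : (ls.map List.reverse).reverse.flatten = ls.flatten.reverse := by
    rw [List.reverse_flatten]
  refine ⟨run ls.flatten.reverse, ⟨(ls.map List.reverse).reverse, ?_, ?_, ?_, ?_, ?_⟩, ?_, ?_⟩
  · intro l hl
    obtain ⟨l, hl', rfl⟩ := List.mem_map.mp (List.mem_reverse.mp hl)
    rw [List.pairwise_reverse]
    exact (h1 l hl').imp fun h => h.symm
  · intro l hl g hg
    obtain ⟨l, hl', rfl⟩ := List.mem_map.mp (List.mem_reverse.mp hl)
    exact h2 l hl' g (List.mem_reverse.mp hg)
  · rwa [e, List.length_reverse]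
  · simpa using h4
  · rw [e]; exact fun _ => rfl
  · intro x; rw [← h5, run_reverse_run]
  · intro x; rw [← h5, run_run_reverse]

end Impl

/-- The head layer of the second circuit moves past the tail of the first, as they share no qubit.
-/
theorem run_zipLayers : ∀ (ls ms : List (List (Gate Q))) (x : Q → Bool),
    (∀ g ∈ ls.flatten, ∀ h ∈ ms.flatten, Disjoint g.support h.support) →
    run (zipLayers ls ms).flatten x = run ms.flatten (run ls.flatten x)
  | [], ms, x, _ => by simp [zipLayers]
  | l :: ls, [], x, _ => by simp [zipLayers]
  | l :: ls, m :: ms, x, h => by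
    simp only [List.flatten_cons, List.mem_append] at h
    simp only [zipLayers, List.flatten_cons, run_append]
    rw [run_zipLayers ls ms _ fun g hg g' hg' => h g (.inr hg) g' (.inr hg'),
      run_comm ls.flatten m fun g hg g' hg' => h g (.inr hg) g' (.inl hg')]

theorem Impl.par {S T : List Q} {f g : (Q → Bool) → (Q → Bool)} {s s' d d' : ℕ}
    (hf : Impl S f s d) (hg : Impl T g s' d') (hST : S.Disjoint T) :
    Impl (S ++ T) (fun x => g (f x)) (s + s') (max d d') := by
  obtain ⟨ls, h1, h2, h3, h4, h5⟩ := hf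
  obtain ⟨ms, k1, k2, k3, k4, k5⟩ := hg
  have hdis : ∀ l ∈ ls, ∀ m ∈ ms, ∀ g ∈ l, ∀ h ∈ m, Disjoint g.support h.support :=
    fun l hl m hm g hg h hh => Finset.disjoint_left.mpr fun q hq hq' =>
      hST (h2 l hl g hg q hq) (k2 m hm h hh q hq')
  refine ⟨zipLayers ls ms, ?_, ?_, ?_, ?_, fun x => ?_⟩
  · intro l hl
    obtain ⟨l₁, l₂, h, k, rfl⟩ := exists_of_mem_zipLayers hl
    rw [List.pairwise_append]
    refine ⟨?_, ?_, ?_⟩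
    · rcases h with rfl | h
      · exact List.Pairwise.nil
      · exact h1 _ h
    · rcases k with rfl | k
      · exact List.Pairwise.nil
      · exact k1 _ k
    · rcases h with rfl | h
      · simp
      · rcases k with rfl | k
        · simp
        · exact hdis _ h _ k
  · intro l hl g hg q hq
    obtain ⟨l₁, l₂, h, k, rfl⟩ := exists_of_mem_zipLayers hl
    rw [List.mem_append]
    rcases List.mem_append.mp hg with hg | hg
    · rcases h with rfl | h
      · simp at hg
      · exact Or.inl (h2 _ h g hg q hq)
    · rcases k with rfl | k
      · simp at hg
      · exact Or.inr (k2 _ k g hg q hq)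
  · rw [length_flatten_zipLayers]; omega
  · rw [length_zipLayers]; omega
  · rw [run_zipLayers, h5, k5]
    intro g hg h hh
    obtain ⟨l, hl, hg⟩ := List.mem_flatten.mp hg
    obtain ⟨m, hm, hh⟩ := List.mem_flatten.mp hh
    exact hdis l hl m hm g hg h hh


end

/-! ### Selection lists, toggles, and the merging gadgets -/

section

variable {Q : Type}

/-- Among the items `(e, b)` of the list, the bit `b` of the first one with `e = 0`, and `r` if
there is none. -/
def sel (X : List (Q × Q)) (r : Bool) (x : Q → Bool) : Bool :=
  X.foldr (fun i v => if x i.1 then v else x i.2) r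

@[simp] theorem sel_nil (r : Bool) (x : Q → Bool) : sel [] r x = r := rfl

@[simp] theorem sel_cons (i : Q × Q) (X : List (Q × Q)) (r : Bool) (x : Q → Bool) :
    sel (i :: X) r x = if x i.1 then sel X r x else x i.2 := rfl

theorem sel_append (X Y : List (Q × Q)) (r : Bool) (x : Q → Bool) :
    sel (X ++ Y) r x = sel X (sel Y r x) x := by
  simp [sel]

/-- The qubits of a list of pairs. -/
def pairQubits (X : List (Q × Q)) : List Q := X.flatMap fun i => [i.1, i.2]

@[simp] theorem pairQubits_nil : pairQubits ([] : List (Q × Q)) = [] := rfl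

@[simp] theorem pairQubits_cons (i : Q × Q) (X : List (Q × Q)) :
    pairQubits (i :: X) = i.1 :: i.2 :: pairQubits X := rfl

@[simp] theorem pairQubits_append (X Y : List (Q × Q)) :
    pairQubits (X ++ Y) = pairQubits X ++ pairQubits Y := by
  simp [pairQubits]

theorem mem_pairQubits {X : List (Q × Q)} {q : Q} :
    q ∈ pairQubits X ↔ ∃ i ∈ X, q = i.1 ∨ q = i.2 := by
  simp [pairQubits]

theorem sel_congr {X : List (Q × Q)} {x y : Q → Bool} (h : ∀ q ∈ pairQubits X, x q = y q)
    (r : Bool) : sel X r x = sel X r y := by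
  induction X with
  | nil => rfl
  | cons i X ih =>
    simp only [pairQubits_cons, List.mem_cons, forall_eq_or_imp] at h
    rw [sel_cons, sel_cons, h.1, h.2.1, ih h.2.2]

/-- This is what permits conditionally clean qubits: a wrong value computed for the later items is
harmless whenever an earlier item decides. -/
theorem sel_of_not_forall {X : List (Q × Q)} {x : Q → Bool} (h : ¬ ∀ i ∈ X, x i.1 = true)
    (r r' : Bool) : sel X r x = sel X r' x := by
  induction X with
  | nil => simp at h
  | cons i X ih =>
    simp only [List.mem_cons, forall_eq_or_imp, not_and] at h
    rw [sel_cons, sel_cons]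
    split_ifs with hi
    · exact ih (h hi)
    · rfl

variable [DecidableEq Q]

/-- The map `|x⟩ ↦ |x with the bit t replaced by t ⊕ p(x)⟩`. -/
def toggle (t : Q) (p : (Q → Bool) → Bool) (x : Q → Bool) : Q → Bool :=
  Function.update x t (xor (x t) (p x))

theorem toggle_self (t : Q) (p : (Q → Bool) → Bool) (x : Q → Bool) :
    toggle t p x t = xor (x t) (p x) := by simp [toggle]

theorem toggle_of_ne (p : (Q → Bool) → Bool) (x : Q → Bool) {q t : Q} (h : q ≠ t) :
    toggle t p x q = x q := by simp [toggle, h]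

theorem toggle_apply (t : Q) (p : (Q → Bool) → Bool) (x : Q → Bool) (q : Q) :
    toggle t p x q = if q = t then xor (x t) (p x) else x q := by
  simp [toggle, Function.update_apply]

theorem Impl.gate (g : Gate Q) {S : List Q} (h : ∀ q ∈ g.support, q ∈ S) : Impl S g.act 1 1 :=
  ⟨[[g]], by simp, by simpa using h, by simp, by simp, by simp⟩

theorem Impl.not (t : Q) : Impl [t] (toggle t fun _ => true) 1 1 :=
  (Impl.gate ⟨∅, t, by simp, by simp⟩ (by simp [Gate.support])).congr fun x => by
    simp [Gate.act, toggle]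

/-- The Toffoli gate; for `a = b` it is the `CX` gate. -/
theorem Impl.ccnot {a b t : Q} (ha : t ≠ a) (hb : t ≠ b) :
    Impl [a, b, t] (toggle t fun x => x a && x b) 1 1 :=
  (Impl.gate ⟨{a, b}, t, by simp [ha, hb], Finset.card_le_two⟩
    (by simp [Gate.support])).congr fun x => by
    simp [Gate.act, toggle, Bool.decide_and]

/-- A swap is three `CX` gates; controlling only the middle one by `e` suffices, since the outer two
cancel when it is idle. -/
theorem exists_impl_cswap {e b o : Q} (h : [e, b, o].Nodup) :
    ∃ f, Impl [e, b, o] f 3 3 ∧ ∀ x, f x e = x e ∧ f x b = if x e then x o else x b := by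
  simp only [List.nodup_cons, List.mem_cons, List.not_mem_nil, or_false, not_or] at h
  obtain ⟨⟨h1, h2⟩, h3, -⟩ := h
  refine ⟨_, (((Impl.ccnot (a := b) (b := b) (t := o) (Ne.symm h3) (Ne.symm h3)).mono
    (by simp) le_rfl le_rfl).comp
    ((Impl.ccnot (a := e) (b := o) (t := b) (Ne.symm h1) h3).mono
    (by simp) le_rfl le_rfl)).comp
    ((Impl.ccnot (a := b) (b := b) (t := o) (Ne.symm h3) (Ne.symm h3)).mono
    (by simp) le_rfl le_rfl), fun x => ?_⟩
  constructor
  · simp [toggle_apply, h1, h2]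
  · simp only [toggle_apply, h2, h3, if_true, if_false]
    cases x e <;> cases x b <;> cases x o <;> rfl

/-- Two items are merged into one, on the zero qubit `h₁`; the zero qubit `h₂` is left. -/
theorem exists_impl_merge {e₁ b₁ h₁ e₂ b₂ : Q} (h : [e₁, b₁, h₁, e₂, b₂].Nodup) :
    ∃ f, Impl [e₁, b₁, h₁, e₂, b₂] f 4 4 ∧ ∀ x, x h₁ = false →
      ∀ r, sel [(h₁, b₁)] r (f x) = sel [(e₁, b₁), (e₂, b₂)] r x := by
  simp only [List.nodup_cons, List.mem_cons, List.not_mem_nil, or_false, not_or] at h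
  obtain ⟨f, hf, hf'⟩ := exists_impl_cswap (e := e₁) (b := b₁) (o := b₂) (by simp [h])
  refine ⟨_, (hf.mono (by simp) le_rfl le_rfl).comp
    ((Impl.ccnot (a := e₁) (b := e₂) (t := h₁) (by tauto) (by tauto)).mono (by simp) le_rfl le_rfl),
    fun x hx r => ?_⟩
  have e1 : f x h₁ = x h₁ := hf.of_notMem (by simp; tauto) x
  have e2 : f x e₂ = x e₂ := hf.of_notMem (by simp; tauto) x
  have n1 : ¬ b₁ = h₁ := by tauto
  simp only [sel_cons, sel_nil, toggle_apply, n1, if_true, if_false, e1, e2, hf', hx]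
  cases x e₁ <;> cases x e₂ <;> simp

/-- Four items are merged into one, on the first of two qubits that are `1`; the second one
becomes `0`, and the selecting bits are restored. -/
theorem exists_impl_merge_four {q h e₀ b₀ e₁ b₁ e₂ b₂ e₃ b₃ : Q}
    (hn : [q, h, e₀, b₀, e₁, b₁, e₂, b₂, e₃, b₃].Nodup) :
    ∃ f, Impl [q, h, e₀, b₀, e₁, b₁, e₂, b₂, e₃, b₃] f 17 17 ∧
      ∀ x, x q = true → x h = true → f x h = false ∧
        (∀ r, sel [(q, b₀)] r (f x) = sel [(e₀, b₀), (e₁, b₁), (e₂, b₂), (e₃, b₃)] r x) ∧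
        f x e₀ = x e₀ ∧ f x e₁ = x e₁ ∧ f x e₂ = x e₂ ∧ f x e₃ = x e₃ := by
  simp only [List.nodup_cons, List.mem_cons, List.not_mem_nil, or_false, not_or] at hn
  obtain ⟨f, hf, hf'⟩ := exists_impl_cswap (e := e₂) (b := b₂) (o := b₃) (by simp [hn])
  obtain ⟨g, hg, hg'⟩ := exists_impl_cswap (e := e₁) (b := b₁) (o := b₂) (by simp [hn])
  obtain ⟨k, hk, hk'⟩ := exists_impl_cswap (e := e₀) (b := b₀) (o := b₁) (by simp [hn])
  -- Controlled swaps from the last item to the first carry the selected bit to `b₀`, with the bit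
  -- of the fourth item as default.
  have hc : Impl [q, h, e₀, b₀, e₁, b₁, e₂, b₂, e₃, b₃] (fun x => k (g (f x))) 9 9 :=
    ((hf.mono (by simp) le_rfl le_rfl).comp (hg.mono (by simp) le_rfl le_rfl)).comp
      (hk.mono (by simp) le_rfl le_rfl)
  -- After both `X` gates, `h` holds `e₀e₁`. Adding `e₀e₃` to `q` before and `(e₀ ⊕ e₀e₁e₂)e₃` after
  -- `e₀` is modified leaves `e₀e₁e₂e₃` there; the last two gates restore `e₀` and clear `h`.
  have ha : Impl [q, h, e₀, b₀, e₁, b₁, e₂, b₂, e₃, b₃] _ 8 8 :=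
    ((((((((Impl.not q).mono (by simp) le_rfl le_rfl).comp
    ((Impl.not h).mono (by simp) le_rfl le_rfl)).comp
    ((Impl.ccnot (a := e₀) (b := e₁) (t := h) (by grind only) (by grind only)).mono
      (by simp) le_rfl le_rfl)).comp
    ((Impl.ccnot (a := e₀) (b := e₃) (t := q) (by grind only) (by grind only)).mono
      (by simp) le_rfl le_rfl)).comp
    ((Impl.ccnot (a := h) (b := e₂) (t := e₀) (by grind only) (by grind only)).mono
      (by simp) le_rfl le_rfl)).comp
    ((Impl.ccnot (a := e₀) (b := e₃) (t := q) (by grind only) (by grind only)).mono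
      (by simp) le_rfl le_rfl)).comp
    ((Impl.ccnot (a := h) (b := e₂) (t := e₀) (by grind only) (by grind only)).mono
      (by simp) le_rfl le_rfl)).comp
    ((Impl.ccnot (a := e₀) (b := e₁) (t := h) (by grind only) (by grind only)).mono
      (by simp) le_rfl le_rfl)
  refine ⟨_, hc.comp ha, fun x hx hx' => ?_⟩
  obtain ⟨y, hy⟩ : ∃ y, k (g (f x)) = y := ⟨_, rfl⟩
  have hout : ∀ p, p ≠ b₀ → p ≠ b₁ → p ≠ b₂ → p ≠ b₃ → y p = x p := fun p p0 p1 p2 p3 => by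
    have hk0 : ∀ z, k z p = z p := fun z =>
      if hp : p = e₀ then by rw [hp, (hk' z).1] else hk.of_notMem (by simp [*]) z
    have hg0 : ∀ z, g z p = z p := fun z =>
      if hp : p = e₁ then by rw [hp, (hg' z).1] else hg.of_notMem (by simp [*]) z
    have hf0 : ∀ z, f z p = z p := fun z =>
      if hp : p = e₂ then by rw [hp, (hf' z).1] else hf.of_notMem (by simp [*]) z
    rw [← hy, hk0, hg0, hf0]
  have hb : y b₀ = sel [(e₀, b₀), (e₁, b₁), (e₂, b₂)] (x b₃) x := by
    have t1 : g (f x) e₀ = x e₀ := by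
      rw [hg.of_notMem (by simp; grind only), hf.of_notMem (by simp; grind only)]
    have t2 : g (f x) b₀ = x b₀ := by
      rw [hg.of_notMem (by simp; grind only), hf.of_notMem (by simp; grind only)]
    have t3 : f x e₁ = x e₁ := hf.of_notMem (by simp; grind only) x
    have t4 : f x b₁ = x b₁ := hf.of_notMem (by simp; grind only) x
    rw [← hy, (hk' _).2, t1, t2, (hg' _).2, t3, t4, (hf' _).2]
    rfl
  have y0 := hout e₀ (by grind only) (by grind only) (by grind only) (by grind only)
  have y1 := hout e₁ (by grind only) (by grind only) (by grind only) (by grind only)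
  have y2 := hout e₂ (by grind only) (by grind only) (by grind only) (by grind only)
  have y3 := hout e₃ (by grind only) (by grind only) (by grind only) (by grind only)
  have yq := hout q (by grind only) (by grind only) (by grind only) (by grind only)
  have yh := hout h (by grind only) (by grind only) (by grind only) (by grind only)
  simp only [hy]
  have hne : ¬ h = q ∧ ¬ e₀ = q ∧ ¬ e₀ = h ∧ ¬ e₁ = q ∧ ¬ e₁ = h ∧ ¬ e₁ = e₀ ∧ ¬ e₂ = q ∧ ¬ e₂ = h ∧
    ¬ e₂ = e₀ ∧ ¬ e₃ = q ∧ ¬ e₃ = h ∧ ¬ e₃ = e₀ ∧ ¬ b₀ = q ∧ ¬ b₀ = h ∧ ¬ b₀ = e₀ ∧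
    ¬ q = h ∧ ¬ q = e₀ ∧ ¬ h = e₀ := by
    refine ⟨?_, ?_, ?_, ?_, ?_, ?_, ?_, ?_, ?_, ?_, ?_, ?_, ?_, ?_, ?_, ?_, ?_, ?_⟩ <;> grind only
  clear hc ha hf hg hk hf' hg' hk' hout hn hy
  simp only [toggle_apply, hne, if_true, if_false, sel_cons, sel_nil, y0, y1, y2, y3, yq, yh, hx,
    hx', hb]
  generalize x e₀ = v0, x e₁ = v1, x e₂ = v2, x e₃ = v3, x b₀ = w0, x b₁ = w1, x b₂ = w2,
    x b₃ = w3
  revert v0 v1 v2 v3 w0 w1 w2 w3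
  decide


end

/-! ### Selection in logarithmic depth with conditionally clean qubits -/

section

variable {Q : Type}

/-- The qubits of a list of items, each with a further qubit. -/
def tripleQubits (R : List ((Q × Q) × Q)) : List Q := R.flatMap fun r => [r.1.1, r.1.2, r.2]

@[simp] theorem tripleQubits_cons (r : (Q × Q) × Q) (R : List ((Q × Q) × Q)) :
    tripleQubits (r :: R) = r.1.1 :: r.1.2 :: r.2 :: tripleQubits R := rfl

@[simp] theorem tripleQubits_append (R R' : List ((Q × Q) × Q)) :
    tripleQubits (R ++ R') = tripleQubits R ++ tripleQubits R' := by
  simp [tripleQubits]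

variable [DecidableEq Q]

/-- Items with a zero qubit each are merged into one item in logarithmic depth. -/
theorem exists_impl_tree (K : ℕ) : ∀ R : List ((Q × Q) × Q), R ≠ [] → R.length ≤ 2 ^ K →
    (tripleQubits R).Nodup → ∃ f D B h s, s + 4 ≤ 4 * R.length ∧
      Impl (tripleQubits R) f s (4 * K) ∧ [D, B, h].Nodup ∧ [D, B, h] ⊆ tripleQubits R ∧
      ∀ x, (∀ r ∈ R, x r.2 = false) → f x h = false ∧
        ∀ r, sel [(D, B)] r (f x) = sel (R.map Prod.fst) r x := by
  induction K with
  | zero =>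
    rintro R hR hl hn
    obtain ⟨⟨⟨D, B⟩, h⟩, rfl⟩ : ∃ a, R = [a] :=
      List.length_eq_one_iff.mp (le_antisymm (by simpa using hl) (List.length_pos_iff.mpr hR))
    exact ⟨id, D, B, h, 0, by simp, Impl.refl _, hn, List.Subset.refl _, by simp⟩
  | succ K ih =>
    intro R hR hl hn
    by_cases hK : R.length ≤ 2 ^ K
    · obtain ⟨f, D, B, h, s, h1, h2, h3⟩ := ih R hR hK hn
      exact ⟨f, D, B, h, s, h1, h2.mono (List.Subset.refl _) le_rfl (by omega), h3⟩
    push Not at hK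
    obtain ⟨R₁, R₂, rfl, hl₁, hl₂⟩ : ∃ R₁ R₂, R = R₁ ++ R₂ ∧ R₁.length = 2 ^ K ∧
        R₂.length = R.length - 2 ^ K :=
      ⟨R.take (2 ^ K), R.drop (2 ^ K), (List.take_append_drop _ _).symm,
        by rw [List.length_take, min_eq_left hK.le], by simp⟩
    have hpos : 0 < 2 ^ K := by positivity
    rw [pow_succ] at hl
    rw [tripleQubits_append] at hn
    obtain ⟨hn₁, hn₂, hn₃⟩ := List.nodup_append.mp hn
    obtain ⟨f₁, D₁, B₁, h₁, s₁, ks₁, i₁, kn₁, kS₁, c₁⟩ :=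
      ih R₁ (List.length_pos_iff.mp (by omega)) hl₁.le hn₁
    obtain ⟨f₂, D₂, B₂, h₂, s₂, ks₂, i₂, kn₂, kS₂, c₂⟩ :=
      ih R₂ (List.length_pos_iff.mp (by omega)) (by omega) hn₂
    have hdis : ∀ q ∈ tripleQubits R₁, q ∉ tripleQubits R₂ := fun q h h' => hn₃ q h q h' rfl
    simp only [List.cons_subset, List.nil_subset, and_true] at kS₁ kS₂
    have d1 := hdis _ kS₁.1
    have d2 := hdis _ kS₁.2.1
    have d3 := hdis _ kS₁.2.2
    simp only [List.nodup_cons, List.mem_cons, List.not_mem_nil, or_false, not_or] at kn₁ kn₂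
    have hne : [D₁, B₁, h₁, D₂, B₂].Nodup ∧ [h₁, B₁, h₂].Nodup ∧ h₂ ∉ [D₁, B₁, h₁, D₂, B₂] := by
      simp only [List.nodup_cons, List.mem_cons, List.not_mem_nil, or_false, not_or]
      grind only
    obtain ⟨m, im, cm⟩ := exists_impl_merge hne.1
    refine ⟨_, h₁, B₁, h₂, s₁ + s₂ + 4, ?_,
      ((i₁.par i₂ fun q h h' => hdis q h h').comp (im.mono ?_ le_rfl le_rfl)).mono ?_ le_rfl ?_,
      hne.2.1, ?_, fun x hx => ?_⟩
    · rw [List.length_append] at *; omega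
    · simp [kS₁, kS₂]
    · simp
    · rw [max_self]; omega
    · simp [kS₁, kS₂]
    have a₁ : ∀ q ∈ tripleQubits R₁, f₂ (f₁ x) q = f₁ x q := fun q hq =>
      i₂.of_notMem (hdis q hq) _
    have a₂ : ∀ q ∈ tripleQubits R₂, f₂ (f₁ x) q = f₂ x q := fun q hq => by
      have e : ∀ q ∈ tripleQubits R₂, f₁ x q = x q := fun q hq =>
        i₁.of_notMem (fun h => hdis q h hq) x
      exact i₂.agree e (e q hq)
    obtain ⟨u₁, v₁⟩ := c₁ x fun r hr => hx r (by simp [hr])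
    obtain ⟨u₂, v₂⟩ := c₂ x fun r hr => hx r (by simp [hr])
    constructor
    -- The merge consumes only the zero qubit of the left half; that of the right half is passed up
    -- the tree.
    · rw [im.of_notMem hne.2.2, a₂ _ kS₂.2.2, u₂]
    · intro r
      rw [cm _ (by rw [a₁ _ kS₁.2.2, u₁]), List.map_append, sel_append, ← v₁, ← v₂]
      simp only [sel_cons, sel_nil, a₁ _ kS₁.1, a₁ _ kS₁.2.1, a₂ _ kS₂.1, a₂ _ kS₂.2.1]

/-- With two qubits in state `1` for every four items, the items are merged in fours. -/
theorem exists_impl_stage : ∀ H X : List (Q × Q), X.length = 4 * H.length →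
    (pairQubits H ++ pairQubits X).Nodup → ∃ f R H', Impl (pairQubits H ++ pairQubits X) f
      (17 * H.length) 17 ∧ R.length = H.length ∧ H'.length = 2 * H.length ∧
      (tripleQubits R ++ pairQubits H').Nodup ∧
      tripleQubits R ++ pairQubits H' ⊆ pairQubits H ++ pairQubits X ∧
      ∀ x, (∀ q ∈ pairQubits H, x q = true) → (∀ r ∈ R, f x r.2 = false) ∧
        (∀ r, sel (R.map Prod.fst) r (f x) = sel X r x) ∧
        ((∀ i ∈ X, x i.1 = true) → ∀ q ∈ pairQubits H', f x q = true) := by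
  intro H
  induction H with
  | nil =>
    rintro X hX -
    obtain rfl := List.length_eq_zero_iff.mp hX
    exact ⟨id, [], [], (Impl.refl _).mono (List.Subset.refl _) (by simp) (by simp), by simp [tripleQubits]⟩
  | cons p H ih =>
    obtain ⟨q, h⟩ := p
    rintro (_ | ⟨⟨e₀, b₀⟩, _ | ⟨⟨e₁, b₁⟩, _ | ⟨⟨e₂, b₂⟩, _ | ⟨⟨e₃, b₃⟩, X⟩⟩⟩⟩) hX hn <;>
      simp only [List.length_cons, List.length_nil] at hX <;> try omega
    have hp : (pairQubits ((q, h) :: H) ++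
        pairQubits ((e₀, b₀) :: (e₁, b₁) :: (e₂, b₂) :: (e₃, b₃) :: X)).Perm
        ([q, h, e₀, b₀, e₁, b₁, e₂, b₂, e₃, b₃] ++ (pairQubits H ++ pairQubits X)) := by
      have := (List.perm_append_comm (l₁ := pairQubits H)
        (l₂ := [e₀, b₀, e₁, b₁, e₂, b₂, e₃, b₃])).append_right (pairQubits X)
      simpa using this
    obtain ⟨n₁, n₂, n₃⟩ := List.nodup_append.mp (hp.nodup hn)
    obtain ⟨f, R, H', i₁, l₁, l₂, m₁, m₂, c₁⟩ := ih X (by omega) n₂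
    obtain ⟨g, i₂, c₂⟩ := exists_impl_merge_four n₁
    refine ⟨_, ((q, b₀), h) :: R, (e₀, e₁) :: (e₂, e₃) :: H', (i₂.par i₁ fun p h h' =>
      n₃ p h p h' rfl).mono hp.symm.subset (by simp; omega) (by simp), by simp [l₁],
      by simp [l₂]; omega, ?_, ?_, fun x hx => ?_⟩
    · have hp' : (tripleQubits (((q, b₀), h) :: R) ++ pairQubits ((e₀, e₁) :: (e₂, e₃) :: H')).Perm
          ([q, b₀, h, e₀, e₁, e₂, e₃] ++ (tripleQubits R ++ pairQubits H')) := by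
        have := (List.perm_append_comm (l₁ := tripleQubits R)
          (l₂ := [e₀, e₁, e₂, e₃])).append_right (pairQubits H')
        simpa using this
      refine hp'.symm.nodup (List.nodup_append.mpr ⟨?_, m₁, fun a ha b hb => ?_⟩)
      · simp only [List.nodup_cons, List.mem_cons, List.not_mem_nil, or_false, not_or] at n₁ ⊢
        grind only
      · exact n₃ a (by simp at ha ⊢; tauto) b (m₂ hb)
    · intro a ha
      refine hp.symm.subset ?_
      rw [List.mem_append]
      by_cases h' : a ∈ tripleQubits R ++ pairQubits H'
      · exact Or.inr (m₂ h')
      · left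
        simp at ha h' ⊢
        tauto
    · have o₁ : ∀ a ∈ pairQubits H ++ pairQubits X, g x a = x a := fun a ha =>
        i₂.of_notMem (fun h => n₃ a h a ha rfl) x
      have o₂ : ∀ a ∈ [q, h, e₀, b₀, e₁, b₁, e₂, b₂, e₃, b₃], f (g x) a = g x a := fun a ha =>
        i₁.of_notMem (fun h => n₃ a ha a h rfl) _
      simp only [pairQubits_cons, List.mem_cons, forall_eq_or_imp] at hx
      obtain ⟨u₁, u₂, u₃, u₄, u₅, u₆⟩ := c₂ x hx.1 hx.2.1
      obtain ⟨v₁, v₂, v₃⟩ := c₁ (g x) fun a ha => by rw [o₁ a (by simp [ha])]; exact hx.2.2 a ha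
      refine ⟨?_, fun r => ?_, fun hX' => ?_⟩
      · simp only [List.mem_cons, forall_eq_or_imp]
        exact ⟨by rw [o₂ _ (by simp), u₁], v₁⟩
      · have e1 : sel ((e₀, b₀) :: (e₁, b₁) :: (e₂, b₂) :: (e₃, b₃) :: X) r x =
            sel [(e₀, b₀), (e₁, b₁), (e₂, b₂), (e₃, b₃)] (sel X r x) x := rfl
        rw [e1, ← u₂, List.map_cons, sel_cons, v₂,
          sel_congr (x := g x) (y := x) fun a ha => o₁ a (by simp [ha])]
        simp only [sel_cons, sel_nil]
        rw [o₂ q (by simp), o₂ b₀ (by simp)]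
      · simp only [List.mem_cons, forall_eq_or_imp] at hX'
        obtain ⟨w₀, w₁, w₂, w₃, hX'⟩ := hX'
        simp only [pairQubits_cons, List.mem_cons, forall_eq_or_imp]
        refine ⟨by rw [o₂ _ (by simp), u₃, w₀], by rw [o₂ _ (by simp), u₄, w₁],
          by rw [o₂ _ (by simp), u₅, w₂], by rw [o₂ _ (by simp), u₆, w₃], v₃ fun i hi => ?_⟩
        rw [o₁ _ (List.mem_append_right _ (mem_pairQubits.mpr ⟨i, hi, Or.inl rfl⟩))]
        exact hX' i hi

/-- Sequential selection, with one qubit in state `1`. -/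
theorem exists_impl_chain (q : Q) (r : Bool) : ∀ X : List (Q × Q), (q :: pairQubits X).Nodup →
    ∃ f o, o ∈ q :: pairQubits X ∧
      Impl (q :: pairQubits X) f (3 * X.length + 1) (3 * X.length + 1) ∧
      ∀ x, x q = true → f x o = sel X r x := by
  intro X
  induction X with
  | nil =>
    intro _
    cases r
    · exact ⟨_, q, by simp, Impl.not q, fun x hx => by simp [toggle_self, hx]⟩
    · exact ⟨id, q, by simp, (Impl.refl _).mono (List.Subset.refl _) (by simp) (by simp),
        fun x hx => by simp [hx]⟩
  | cons i X ih =>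
    obtain ⟨e, b⟩ := i
    intro hn
    simp only [pairQubits_cons, List.nodup_cons, List.mem_cons, not_or] at hn
    obtain ⟨f, o, ho, hf, hf'⟩ := ih (by simp [hn])
    have heo : e ∉ q :: pairQubits X := by simp only [List.mem_cons]; grind only
    have hbo : b ∉ q :: pairQubits X := by simp only [List.mem_cons]; grind only
    obtain ⟨c, hc, hc'⟩ := exists_impl_cswap (e := e) (b := b) (o := o) (by
      simp only [List.nodup_cons, List.mem_cons, List.not_mem_nil, or_false, not_or,
        List.nodup_nil]
      grind only)
    refine ⟨_, b, by simp, ((hf.mono (T := q :: pairQubits ((e, b) :: X)) ?_ le_rfl le_rfl).comp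
      (hc.mono ?_ le_rfl le_rfl)).mono (List.Subset.refl _)
      (by simp; omega) (by simp; omega), fun x hx => ?_⟩
    · intro a ha; simp at ha ⊢; tauto
    · simp at ho ⊢; tauto
    · rw [(hc' _).2, hf.of_notMem heo, hf.of_notMem hbo, hf' x hx, sel_cons]

/-- Selection in logarithmic depth, with at least two qubits in state `1`. -/
theorem exists_impl_sel (K : ℕ) (r : Bool) : ∀ (N : ℕ) (H X : List (Q × Q)), H ≠ [] →
    X.length ≤ 4 * H.length * (2 ^ N - 1) + 3 → X.length ≤ 2 ^ K →
    (pairQubits H ++ pairQubits X).Nodup →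
    ∃ f o, o ∈ pairQubits H ++ pairQubits X ∧
      Impl (pairQubits H ++ pairQubits X) f (6 * X.length + 1) (20 * N + 4 * K + 10) ∧
      ∀ x, (∀ q ∈ pairQubits H, x q = true) → f x o = sel X r x := by
  have base : ∀ (N : ℕ) (H X : List (Q × Q)), H ≠ [] → X.length ≤ 3 →
      (pairQubits H ++ pairQubits X).Nodup →
      ∃ f o, o ∈ pairQubits H ++ pairQubits X ∧
        Impl (pairQubits H ++ pairQubits X) f (6 * X.length + 1) (20 * N + 4 * K + 10) ∧
        ∀ x, (∀ q ∈ pairQubits H, x q = true) → f x o = sel X r x := by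
    rintro N (_ | ⟨⟨q, h⟩, H⟩) X hH hX hn
    · exact absurd rfl hH
    have hs : q :: pairQubits X ⊆ pairQubits ((q, h) :: H) ++ pairQubits X := by
      intro a ha; simp at ha ⊢; tauto
    have hn' : (q :: pairQubits X).Nodup := by
      refine hn.sublist (List.Sublist.cons_cons _ ?_)
      exact List.Sublist.cons _ (List.sublist_append_right _ _)
    obtain ⟨f, o, ho, hf, hf'⟩ := exists_impl_chain q r X hn'
    exact ⟨f, o, hs ho, hf.mono hs (by omega) (by omega), fun x hx => hf' x (hx q (by simp))⟩
  intro N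
  induction N with
  | zero =>
    intro H X hH hX _ hn
    exact base 0 H X hH (by simpa using hX) hn
  | succ N ih =>
    intro H X hH hX hK hn
    by_cases h3 : X.length ≤ 3
    · exact base _ H X hH h3 hn
    have hHpos : 0 < H.length := List.length_pos_iff.mpr hH
    -- As many groups of four are handled as the pairs of ones and the items permit.
    obtain ⟨p, hp⟩ : ∃ p, p = min H.length (X.length / 4) := ⟨_, rfl⟩
    obtain ⟨H₁, H₂, X₁, X₂, rfl, rfl, hl₁, hl₂⟩ : ∃ H₁ H₂ X₁ X₂, H = H₁ ++ H₂ ∧ X = X₁ ++ X₂ ∧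
        H₁.length = p ∧ X₁.length = 4 * p :=
      ⟨H.take p, H.drop p, X.take (4 * p), X.drop (4 * p), (List.take_append_drop _ _).symm,
        (List.take_append_drop _ _).symm, by simp; omega, by simp; omega⟩
    simp only [List.length_append] at *
    have hp' : (pairQubits (H₁ ++ H₂) ++ pairQubits (X₁ ++ X₂)).Perm
        ((pairQubits H₁ ++ pairQubits X₁) ++ (pairQubits H₂ ++ pairQubits X₂)) := by
      rw [pairQubits_append, pairQubits_append, List.append_assoc, List.append_assoc]
      refine List.Perm.append_left _ ?_
      rw [← List.append_assoc, ← List.append_assoc]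
      exact List.Perm.append_right _ List.perm_append_comm
    obtain ⟨n₁, n₂, n₃⟩ := List.nodup_append.mp (hp'.nodup hn)
    obtain ⟨g, R, H', ig, lR, lH', nR, sR, cg⟩ := exists_impl_stage H₁ X₁ (by omega) n₁
    obtain ⟨nR₁, nR₂, nR₃⟩ := List.nodup_append.mp nR
    obtain ⟨t, D, B, h, s, hs, it, nD, sD, ct⟩ := exists_impl_tree K R
      (List.length_pos_iff.mp (by omega)) (by omega) nR₁
    have nH' : (pairQubits H' ++ pairQubits X₂).Nodup :=
      List.nodup_append.mpr ⟨nR₂, (List.nodup_append.mp n₂).2.1, fun a ha b hb =>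
        n₃ a (sR (by simp [ha])) b (by simp [hb])⟩
    -- Either all pairs of `H` are used, and their doubling matches `2 ^ (N + 1) - 1 = 2 * (2 ^ N -
    -- 1) + 1`, or at most three items remain.
    have hlen : X₂.length ≤ 4 * H'.length * (2 ^ N - 1) + 3 := by
      obtain ⟨m, hm⟩ : ∃ m, 2 ^ N = m + 1 := ⟨2 ^ N - 1, by have := Nat.one_le_two_pow (n := N); omega⟩
      rcases min_choice (H₁.length + H₂.length) ((X₁.length + X₂.length) / 4) with h | h
      · have h2 : H₂.length = 0 := by omega
        have e1 : 2 ^ (N + 1) - 1 = 2 * m + 1 := by rw [pow_succ, hm]; omega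
        have e2 : 2 ^ N - 1 = m := by omega
        rw [e1, h2, hl₁] at hX
        rw [e2, lH', hl₁]
        nlinarith
      · have : X₂.length ≤ 3 := by omega
        omega
    obtain ⟨f, o, ho, iF, cf⟩ := ih H' X₂ (List.length_pos_iff.mp (by omega)) hlen (by omega) nH'
    simp only [List.cons_subset, List.nil_subset, and_true] at sD
    have hdis : ∀ a ∈ tripleQubits R, a ∉ pairQubits H' ++ pairQubits X₂ := by
      intro a ha ha'
      rcases List.mem_append.mp ha' with h | h
      · exact nR₃ a ha a h rfl
      · exact n₃ a (sR (by simp [ha])) a (by simp [h]) rfl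
    have hDo := hdis D sD.1
    have hBo := hdis B sD.2.1
    have nDB : [D, B, o].Nodup := by
      simp only [List.nodup_cons, List.mem_cons, List.not_mem_nil, or_false, not_or,
        List.nodup_nil] at nD ⊢
      refine ⟨⟨nD.1.1, fun e => hDo (e ▸ ho)⟩, fun e => hBo (e ▸ ho), not_false, trivial⟩
    obtain ⟨c, ic, cc⟩ := exists_impl_cswap nDB
    have sub₁ : pairQubits H₁ ++ pairQubits X₁ ⊆
        pairQubits (H₁ ++ H₂) ++ pairQubits (X₁ ++ X₂) := fun a ha =>
      hp'.symm.subset (List.mem_append_left _ ha)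
    have sub₂ : pairQubits X₂ ⊆ pairQubits (H₁ ++ H₂) ++ pairQubits (X₁ ++ X₂) := by
      simp [List.subset_def]; tauto
    have sub₃ : tripleQubits R ++ (pairQubits H' ++ pairQubits X₂) ⊆
        pairQubits (H₁ ++ H₂) ++ pairQubits (X₁ ++ X₂) := by
      rw [← List.append_assoc]
      exact List.append_subset.mpr ⟨fun a ha => sub₁ (sR ha), sub₂⟩
    have hBmem := sub₃ (List.mem_append_left _ sD.2.1)
    -- The tree is parallel to the recursive call, whose depth bound already exceeds `4 * K`. Each
    -- level therefore adds only `17 + 3` layers: the stage and the final controlled swap.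
    refine ⟨_, B, hBmem, (((ig.mono sub₁ le_rfl le_rfl).comp
      ((it.par iF fun a h h' => hdis a h h').mono sub₃ le_rfl le_rfl)).comp
      (ic.mono ?_ le_rfl le_rfl)).mono (List.Subset.refl _) (by omega) (by omega), fun x hx => ?_⟩
    · simp only [List.cons_subset, List.nil_subset, and_true]
      exact ⟨sub₃ (List.mem_append_left _ sD.1), hBmem, sub₃ (List.mem_append_right _ ho)⟩
    have hx₁ : ∀ q ∈ pairQubits H₁, x q = true := fun q hq => hx q (by simp [hq])
    obtain ⟨u₁, u₂, u₃⟩ := cg x hx₁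
    obtain ⟨-, v⟩ := ct (g x) u₁
    have w₁ : ∀ a ∈ tripleQubits R, f (t (g x)) a = t (g x) a := fun a ha =>
      iF.of_notMem (hdis a ha) _
    have w₂ : ∀ a ∈ pairQubits H' ++ pairQubits X₂, t (g x) a = g x a := fun a ha =>
      it.of_notMem (fun h => hdis a h ha) _
    have w₃ : ∀ a ∈ pairQubits X₂, t (g x) a = x a := fun a ha => by
      rw [w₂ a (by simp [ha])]
      exact ig.of_notMem (fun h => n₃ a h a (by simp [ha]) rfl) x
    have key : c (f (t (g x))) B = sel X₁ (f (t (g x)) o) x := by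
      rw [(cc _).2, w₁ D sD.1, w₁ B sD.2.1, ← u₂, ← v]
      simp
    rw [key, sel_append]
    -- Only here are the qubits of `H'` known to be `1`; otherwise the value in `o` is arbitrary and
    -- is never selected.
    by_cases hX₁ : ∀ i ∈ X₁, x i.1 = true
    · rw [cf, sel_congr w₃]
      intro q hq
      rw [w₂ q (by simp [hq])]
      exact u₃ hX₁ q hq
    · exact sel_of_not_forall hX₁ _ _


end

/-! ### Multiply controlled toggles with qubits in arbitrary states -/

section

variable {Q : Type}

/-- The default value is reached exactly when every selecting bit is `1`; otherwise the two
selections agree and cancel. The payload bits may thus be arbitrary. -/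
theorem sel_false_xor_sel_true (X : List (Q × Q)) (x : Q → Bool) :
    xor (sel X false x) (sel X true x) = (X.map Prod.fst).all x := by
  induction X with
  | nil => rfl
  | cons i X ih =>
    simp only [sel_cons, List.map_cons, List.all_cons, ← ih]
    cases x i.1 <;> simp

theorem pairQubits_zip_subset (ys ws : List Q) : pairQubits (ys.zip ws) ⊆ ys ++ ws := by
  intro q hq
  obtain ⟨i, hi, h⟩ := mem_pairQubits.mp hq
  have := List.of_mem_zip hi
  rcases h with rfl | rfl
  · exact List.mem_append_left _ this.1
  · exact List.mem_append_right _ this.2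

theorem nodup_pairQubits_zip : ∀ ys ws : List Q, (ys ++ ws).Nodup →
    (pairQubits (ys.zip ws)).Nodup
  | [], ws, _ => by simp
  | y :: ys, [], _ => by simp
  | y :: ys, w :: ws, h => by
    have h' : (y :: w :: (ys ++ ws)).Nodup := by
      refine List.Perm.nodup ?_ h
      simp
    simp only [List.nodup_cons, List.mem_cons, not_or] at h'
    simp only [List.zip_cons_cons, pairQubits_cons, List.nodup_cons, List.mem_cons, not_or]
    exact ⟨⟨h'.1.1, fun h => h'.1.2 (pairQubits_zip_subset _ _ h)⟩,
      fun h => h'.2.1 (pairQubits_zip_subset _ _ h), nodup_pairQubits_zip ys ws h'.2.2⟩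

theorem nodup_pairQubits_map {ι : Type} {A B : ι → Q} (hA : Function.Injective A)
    (hB : Function.Injective B) (hAB : ∀ i j, A i ≠ B j) {L : List ι} (hL : L.Nodup) :
    (pairQubits (L.map fun i => (A i, B i))).Nodup := by
  induction L with
  | nil => simp
  | cons i L ih =>
    obtain ⟨hi, hL⟩ := List.nodup_cons.mp hL
    simp only [List.map_cons, pairQubits_cons, List.nodup_cons, List.mem_cons, not_or,
      mem_pairQubits, List.mem_map]
    refine ⟨⟨hAB _ _, ?_⟩, ?_, ih hL⟩
    · rintro ⟨_, ⟨j, hj, rfl⟩, h | h⟩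
      · exact hi (hA h ▸ hj)
      · exact hAB _ _ h
    · rintro ⟨_, ⟨j, hj, rfl⟩, h | h⟩
      · exact hAB _ _ h.symm
      · exact hi (hB h ▸ hj)

/-- Comparison of two integers, from the most significant bit in which they differ. -/
theorem sel_reverse_finRange (y : Q → Bool) (r : Bool) : ∀ (n : ℕ) (α β : Fin n → Bool)
    (A B : Fin n → Q), (∀ i, y (A i) = !(xor (α i) (β i))) → (∀ i, y (B i) = β i) →
    sel ((List.finRange n).reverse.map fun i => (A i, B i)) r y =
      if Nat.ofBits α = Nat.ofBits β then r else decide (Nat.ofBits α < Nat.ofBits β)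
  | 0, α, β, A, B, _, _ => by simp [Nat.ofBits_zero]
  | n + 1, α, β, A, B, hA, hB => by
    have ih := fun r => sel_reverse_finRange y r n (α ∘ Fin.succ) (β ∘ Fin.succ) (A ∘ Fin.succ)
      (B ∘ Fin.succ) (fun i => hA _) (fun i => hB _)
    rw [List.finRange_succ, List.reverse_cons, List.map_append, sel_append, ← List.map_reverse,
      List.map_map]
    have e : ((fun i => (A i, B i)) ∘ Fin.succ : Fin n → Q × Q) =
      fun i => ((A ∘ Fin.succ) i, (B ∘ Fin.succ) i) := rfl
    rw [e, ih, Nat.ofBits_succ, Nat.ofBits_succ]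
    simp only [List.map_cons, List.map_nil, sel_cons, sel_nil, hA, hB]
    generalize Nat.ofBits (α ∘ Fin.succ) = u
    generalize Nat.ofBits (β ∘ Fin.succ) = v
    by_cases huv : u = v
    · subst huv
      cases α 0 <;> cases β 0 <;> simp
    -- If the higher bits differ, the lowest bit changes neither the equality nor the order.
    · rw [if_neg huv, if_neg (by cases α 0 <;> cases β 0 <;> simp <;> omega), decide_eq_decide]
      cases α 0 <;> cases β 0 <;> simp <;> omega

theorem all_congr {L : List Q} {x y : Q → Bool} (h : ∀ q ∈ L, x q = y q) : L.all x = L.all y := by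
  rw [Bool.eq_iff_iff, List.all_eq_true, List.all_eq_true]
  exact forall₂_congr fun q hq => by rw [h q hq]

variable [DecidableEq Q]

theorem all_update {L : List Q} {q : Q} (hq : q ∉ L) (x : Q → Bool) (v : Bool) :
    L.all (Function.update x q v) = L.all x :=
  all_congr fun _ hp => Function.update_of_ne (ne_of_mem_of_not_mem hp hq) _ _

theorem sel_update {X : List (Q × Q)} {q : Q} (hq : q ∉ pairQubits X) (r : Bool) (x : Q → Bool)
    (v : Bool) : sel X r (Function.update x q v) = sel X r x :=
  sel_congr (fun _ hp => Function.update_of_ne (ne_of_mem_of_not_mem hp hq) _ _) r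

namespace Impl

variable {S T : List Q} {f : (Q → Bool) → (Q → Bool)} {p p' A : (Q → Bool) → Bool} {a z : Q}
  {s s' d d' : ℕ}

/-- Compute, toggle, uncompute: `z` is outside the qubits of `f`, so toggling it does not disturb
the uncomputation. -/
theorem conj_toggle (hf : Impl S f s d) (hz : z ∉ S) (hST : S ⊆ T)
    (hp : Impl T (toggle z p) s' d') :
    Impl T (toggle z fun x => p (f x)) (s + s' + s) (d + d' + d) := by
  obtain ⟨f', hf', h1, -⟩ := hf.exists_inverse
  refine (((hf.mono hST le_rfl le_rfl).comp hp).comp (hf'.mono hST le_rfl le_rfl)).congr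
    fun x => funext fun q => ?_
  by_cases hq : q = z
  · subst hq
    rw [hf'.of_notMem hz, toggle_self, toggle_self, hf.of_notMem hz]
  · rw [toggle_of_ne _ _ hq]
    have e : f' (toggle z p (f x)) q = f' (f x) q :=
      hf'.agree (fun a ha => toggle_of_ne _ _ (ne_of_mem_of_not_mem ha hz)) (toggle_of_ne _ _ hq)
    rw [e, h1]

theorem toggle_xor (hp : Impl S (toggle z p) s d) (hp' : Impl S (toggle z p') s' d')
    (hz : ∀ x v, p' (Function.update x z v) = p' x) :
    Impl S (toggle z fun x => xor (p x) (p' x)) (s + s') (d + d') :=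
  (hp.comp hp').congr fun x => funext fun q => by
    have : p' (toggle z p x) = p' x := hz x _
    rw [toggle_apply, toggle_apply, toggle_apply, toggle_apply, if_pos rfl, this]
    split_ifs
    · rw [Bool.xor_assoc]
    · rfl

/-- A control on a qubit in an arbitrary state is replaced by the predicate toggling it. -/
theorem toggle_and (haz : a ≠ z) (hA : ∀ x v, A (Function.update x a v) = A x)
    (hA' : ∀ x v, A (Function.update x z v) = A x) (hp : ∀ x v, p (Function.update x a v) = p x)
    (hp' : ∀ x v, p (Function.update x z v) = p x)
    (h : Impl S (toggle z fun x => x a && p x) s d) (h' : Impl S (toggle a A) s' d') :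
    Impl S (toggle z fun x => A x && p x) (2 * s + 2 * s') (2 * d + 2 * d') := by
  -- The two toggles of `z` add `a·p` and `(a ⊕ A)·p`, whose sum is `A·p`; the second toggle of `a`
  -- restores it.
  refine ((((h.comp h').comp h).comp h').congr fun x => funext fun q => ?_).mono
    (List.Subset.refl _) (by omega) (by omega)
  have e1 : ∀ p' x, A (toggle z p' x) = A x := fun p' x => hA' x _
  have e2 : ∀ p' x, A (toggle a p' x) = A x := fun p' x => hA x _
  have e3 : ∀ p' x, p (toggle z p' x) = p x := fun p' x => hp' x _
  have e4 : ∀ p' x, p (toggle a p' x) = p x := fun p' x => hp x _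
  simp only [toggle_apply, e1, e2, e3, e4, haz, haz.symm, if_true, if_false]
  by_cases h1 : q = a
  · subst h1
    simp [haz]
  · by_cases h2 : q = z
    · subst h2
      simp only [h1, if_true, if_false]
      cases x a <;> cases x q <;> cases A x <;> cases p x <;> rfl
    · simp [h1, h2]

end Impl

/-- The controls `t₁`, `t₂` double as the two ones required by `exists_impl_sel`. The qubit `a`
stands in for their conjunction while they are being overwritten, and `Impl.toggle_and` then
replaces it. -/
theorem impl_toggle_sel {t₁ t₂ a z : Q} {X : List (Q × Q)} (K : ℕ) (r : Bool)
    (hK : X.length ≤ 2 ^ K) (hn : (t₁ :: t₂ :: a :: z :: pairQubits X).Nodup) :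
    Impl (t₁ :: t₂ :: a :: z :: pairQubits X)
      (toggle z fun x => (x t₁ && x t₂) && sel X r x) (24 * X.length + 8) (96 * K + 44) := by
  simp only [List.nodup_cons, List.mem_cons, not_or] at hn
  obtain ⟨⟨h1, h2, h3, h4⟩, ⟨h5, h6, h7⟩, ⟨h8, h9⟩, h10, h11⟩ := hn
  have hpos : 1 ≤ 2 ^ K := Nat.one_le_two_pow
  obtain ⟨f, o, ho, hf, hf'⟩ := exists_impl_sel K r K [(t₁, t₂)] X (by simp)
    (by simp; omega) hK (by simp [*])
  have hS : ∀ q, q ≠ t₁ → q ≠ t₂ → q ∉ pairQubits X →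
    q ∉ pairQubits [(t₁, t₂)] ++ pairQubits X := fun q e1 e2 e3 => by simp [*]
  have ha := hS a (Ne.symm h2) (Ne.symm h5) h9
  have hz := hS z (Ne.symm h3) (Ne.symm h6) h10
  have hsub : pairQubits [(t₁, t₂)] ++ pairQubits X ⊆ t₁ :: t₂ :: a :: z :: pairQubits X := by
    intro q hq; simp at hq ⊢; tauto
  have key : Impl (t₁ :: t₂ :: a :: z :: pairQubits X) (toggle z fun x => x a && f x o)
      (12 * X.length + 3) (48 * K + 21) := by
    refine ((hf.conj_toggle hz hsub ((Impl.ccnot (a := a) (b := o) (t := z) (Ne.symm h8)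
      (fun e => hz (e ▸ ho))).mono ?_ le_rfl le_rfl)).congr fun x => ?_).mono
      (List.Subset.refl _) (by omega) (by omega)
    · have := hsub ho
      simp at this ⊢; tauto
    · simp only [hf.of_notMem ha]
  have hfu : ∀ q, q ∉ pairQubits [(t₁, t₂)] ++ pairQubits X → ∀ x v,
      f (Function.update x q v) o = f x o := fun q hq x v => by
    have e : ∀ q' ∈ pairQubits [(t₁, t₂)] ++ pairQubits X, Function.update x q v q' = x q' :=
      fun q' h' => Function.update_of_ne (ne_of_mem_of_not_mem h' hq) _ _
    exact hf.agree e (e o ho)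
  refine ((Impl.toggle_and (A := fun x => x t₁ && x t₂) h8 ?_ ?_ (hfu a ha) (hfu z hz) key
    ((Impl.ccnot (a := t₁) (b := t₂) (t := a) (Ne.symm h2) (Ne.symm h5)).mono
    (by simp) le_rfl le_rfl)).congr fun x => ?_).mono (List.Subset.refl _) (by omega) (by omega)
  · intro x v; simp [h2, h5]
  · intro x v; simp [h3, h6]
  · congr 1
    funext x
    -- If the controls are not both `1`, the value in `o` is arbitrary but is multiplied by zero.
    cases h : x t₁ && x t₂
    · rfl
    · rw [hf' x (by simpa using h)]

/-- A multiply controlled `X` with about as many qubits in arbitrary states as controls. -/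
theorem impl_toggle_all_of_length_le {z : Q} {Y W : List Q} (K : ℕ) (hK : Y.length ≤ 2 ^ K)
    (hn : (z :: (Y ++ W)).Nodup) (hW : Y.length ≤ W.length + 1) :
    Impl (z :: (Y ++ W)) (toggle z fun x => Y.all x) (48 * Y.length + 16) (192 * K + 88) := by
  rcases Y with _ | ⟨t₁, _ | ⟨t₂, Y⟩⟩
  · exact ((Impl.not z).congr fun x => by simp [toggle]).mono (by simp) (by simp) (by omega)
  · simp only [List.nodup_cons, List.mem_append, List.mem_cons, List.not_mem_nil, or_false,
      not_or] at hn
    exact ((Impl.ccnot (a := t₁) (b := t₁) hn.1.1 hn.1.1).congr fun x => by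
      simp [toggle]).mono (by simp) (by simp) (by omega)
  · rcases W with _ | ⟨a, W⟩
    · simp at hW
    have hp : (z :: (t₁ :: t₂ :: Y ++ a :: W)).Perm (t₁ :: t₂ :: a :: z :: (Y ++ W)) := by
      have h2 : (z :: (t₁ :: t₂ :: Y ++ a :: W)).Perm (z :: t₁ :: t₂ :: a :: (Y ++ W)) := by
        simp
      exact h2.trans (List.perm_middle (l₁ := [t₁, t₂, a])).symm
    have hn' := hp.nodup hn
    have hs := pairQubits_zip_subset Y W
    have hn2 : (t₁ :: t₂ :: a :: z :: pairQubits (Y.zip W)).Nodup := by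
      have e : ∀ L : List Q, t₁ :: t₂ :: a :: z :: L = [t₁, t₂, a, z] ++ L := fun L => rfl
      rw [e] at hn' ⊢
      obtain ⟨n1, n2, n3⟩ := List.nodup_append.mp hn'
      exact List.nodup_append.mpr ⟨n1, nodup_pairQubits_zip Y W n2,
        fun a ha b hb => n3 a ha b (hs hb)⟩
    simp only [List.length_cons] at hK hW ⊢
    have hl : (Y.zip W).length = Y.length := by rw [List.length_zip]; omega
    have h1 := fun r => impl_toggle_sel K r (by omega : (Y.zip W).length ≤ 2 ^ K) hn2
    have hz : z ∉ pairQubits (Y.zip W) ∧ z ≠ t₁ ∧ z ≠ t₂ := by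
      simp only [List.nodup_cons, List.mem_cons, not_or] at hn2
      grind only
    -- The remaining controls act as selecting bits and the qubits of `W` as payload; the XOR over
    -- both defaults leaves the conjunction.
    refine (((h1 false).toggle_xor (h1 true) fun x v => ?_).congr fun x => ?_).mono ?_
      (by rw [hl]; omega) (by omega)
    · rw [sel_update hz.1]
      simp [hz.2.1.symm, hz.2.2.symm]
    · congr 1
      funext x
      have := sel_false_xor_sel_true (Y.zip W) x
      rw [List.map_fst_zip (by omega)] at this
      rw [← Bool.and_xor_distrib_left, this]
      simp [Bool.and_assoc]
    · intro q hq
      refine hp.symm.subset ?_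
      have := @hs q
      simp at hq this ⊢
      tauto

/-- A multiply controlled `X` with one further qubit in an arbitrary state. -/
theorem impl_toggle_all {z w : Q} {Y : List Q} (K : ℕ) (hK : Y.length ≤ 2 ^ K)
    (hn : (z :: w :: Y).Nodup) :
    Impl (z :: w :: Y) (toggle z fun x => Y.all x) (96 * Y.length + 160) (768 * K + 1120) := by
  obtain ⟨Y₁, Y₂, rfl, hl₁⟩ : ∃ Y₁ Y₂, Y = Y₁ ++ Y₂ ∧ Y₁.length = (Y.length + 1) / 2 :=
    ⟨Y.take ((Y.length + 1) / 2), Y.drop ((Y.length + 1) / 2), (List.take_append_drop _ _).symm,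
      by rw [List.length_take]; omega⟩
  rw [List.length_append] at *
  have hpos : 1 ≤ 2 ^ K := Nat.one_le_two_pow
  have hpow : 2 ^ (K + 1) = 2 * 2 ^ K := by ring
  have p₁ : (z :: w :: (Y₁ ++ Y₂)).Perm (z :: (w :: Y₂ ++ Y₁)) := by
    simpa using List.perm_append_comm
  have p₂ : (z :: w :: (Y₁ ++ Y₂)).Perm (w :: (Y₁ ++ z :: Y₂)) :=
    (List.Perm.swap _ _ _).trans (List.Perm.cons _ List.perm_middle.symm)
  -- Each half of the controls serves as the borrowed qubits for the other: `w` and `Y₂` control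
  -- `z`, then `Y₁` controls `w`.
  have i₁ := impl_toggle_all_of_length_le (K + 1) (by simp; omega) (p₁.nodup hn)
    (by simp; omega)
  have i₂ := impl_toggle_all_of_length_le (K + 1) (by omega) (p₂.nodup hn) (by simp; omega)
  simp only [List.nodup_cons, List.mem_cons, List.mem_append, not_or] at hn
  refine ((Impl.toggle_and (a := w) (A := fun x => Y₁.all x) (p := fun x => Y₂.all x)
    (Ne.symm hn.1.1) (fun x v => all_update hn.2.1.1 x v) (fun x v => all_update hn.1.2.1 x v)
    (fun x v => all_update hn.2.1.2 x v) (fun x v => all_update hn.1.2.2 x v)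
    ((i₁.mono p₁.symm.subset le_rfl le_rfl).congr fun x => by simp)
    (i₂.mono p₂.symm.subset le_rfl le_rfl)).congr fun x => by
      simp [List.all_append]).mono (List.Subset.refl _) (by simp; omega) (by omega)

/-- The controlled selection, with two items or more and one control or more. -/
theorem impl_toggle_all_and_sel {z c e b e' b' : Q} {Y : List Q} {X : List (Q × Q)} (K : ℕ)
    (hY : Y.length + 3 ≤ 2 ^ K) (hX : X.length + 1 ≤ 2 ^ K)
    (hn : (z :: (c :: Y) ++ pairQubits ((e, b) :: (e', b') :: X)).Nodup) :
    Impl (z :: (c :: Y) ++ pairQubits ((e, b) :: (e', b') :: X))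
      (toggle z fun x => (c :: Y).all x && sel ((e, b) :: (e', b') :: X) false x)
      (384 * Y.length + 48 * X.length + 1376) (3264 * K + 4568) := by
  have hsub : ∀ L : List Q, (∀ q ∈ L, q = z ∨ q = c ∨ q ∈ Y ∨ q = e ∨ q = b ∨ q = e' ∨ q = b' ∨
      q ∈ pairQubits X) → L ⊆ z :: (c :: Y) ++ pairQubits ((e, b) :: (e', b') :: X) := by
    intro L hL q hq
    have := hL q hq
    simp
    tauto
  have hn' : z ∉ c :: Y ∧ z ∉ pairQubits ((e', b') :: X) ∧ b ∉ c :: Y ∧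
      b ∉ pairQubits ((e', b') :: X) ∧ b ≠ z ∧ e ≠ z ∧ b ≠ e ∧
      (z :: e :: b :: c :: Y).Nodup ∧ (z :: e' :: b :: e :: c :: Y).Nodup ∧
      (b :: z :: c :: Y).Nodup ∧ (b :: e :: c :: z :: pairQubits ((e', b') :: X)).Nodup := by
    simp only [List.cons_append, List.nodup_cons, List.nodup_append, List.mem_cons,
      List.mem_append, pairQubits_cons, not_or] at hn ⊢
    grind only
  clear hn
  obtain ⟨h1, h2, h3, h4, h5, h6, h7, n1, n2, n3, n4⟩ := hn'
  -- With `v` the conjunction of the controls and `u` the selection from the second item on, the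
  -- target is `v·(b ⊕ b·e ⊕ e·u)`. The toggles `i₁`, `i₂`, `i₅` give its three terms. The first two
  -- borrow `e` and `e'`; for the third, `i₄` toggles by `b·e·u` borrowing `c`, and `i₃` lets `v`
  -- replace `b`.
  have i₁ := (impl_toggle_all K (by simp; omega) n1).mono (hsub _ (by simp +contextual)) le_rfl le_rfl
  have i₂ := (impl_toggle_all K (by simp; omega) n2).mono (hsub _ (by simp +contextual)) le_rfl le_rfl
  have i₃ := (impl_toggle_all K (by simp; omega) n3).mono (hsub _ (by simp +contextual)) le_rfl le_rfl
  have i₄ := (impl_toggle_sel K false (by simp; omega) n4).mono (hsub _ (by simp +contextual)) le_rfl le_rfl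
  have i₅ := Impl.toggle_and (a := b) (z := z) (A := fun x => (c :: Y).all x)
    (p := fun x => x e && sel ((e', b') :: X) false x) h5
    (fun x v => all_update h3 x v) (fun x v => all_update h1 x v)
    (fun x v => by rw [sel_update h4, Function.update_of_ne h7.symm])
    (fun x v => by rw [sel_update h2, Function.update_of_ne h6])
    (i₄.congr fun x => by simp only [Bool.and_assoc]) i₃
  have h8 : z ∉ b :: e :: c :: Y := by simp at h1 ⊢; tauto
  refine (((i₁.toggle_xor i₂ fun x v => all_update h8 x v).toggle_xor i₅ fun x v => ?_).congr
    fun x => ?_).mono (List.Subset.refl _) (by simp; omega) (by omega)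
  · simp only [all_update h1, sel_update h2, Function.update_of_ne h6]
  · congr 1
    funext x
    rw [sel_cons (e, b), List.all_cons (a := b), List.all_cons (a := b), List.all_cons (a := e)]
    generalize sel ((e', b') :: X) false x = u
    generalize (c :: Y).all x = v
    dsimp only
    generalize x b = w₁, x e = w₂
    revert u v w₁ w₂
    decide


end

/-! ### From basis-state maps to operators and circuits -/

section

variable {Q : Type}

theorem basisOperator_injective [Fintype Q] :
    Function.Injective (basisOperator : ((Q → Bool) → (Q → Bool)) → Operator Q) := by
  intro f g h
  funext x
  have := congrFun (congrFun h (f x)) x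
  by_contra hne
  simp [basisOperator, hne] at this

theorem basisOperator_id [Fintype Q] : basisOperator (fun x : Q → Bool => x) = 1 := by
  ext y x
  simp [Matrix.one_apply, basisOperator]

variable [DecidableEq Q]

theorem basisOperator_mul [Fintype Q] (f g : (Q → Bool) → (Q → Bool)) :
    basisOperator f * basisOperator g = basisOperator fun x => f (g x) := by
  ext y x
  simp [Matrix.mul_apply, basisOperator]

theorem foldr_operator [Fintype Q] (gs : List (Gate Q)) :
    gs.foldr (fun g U => U * g.operator) 1 = basisOperator (run gs) := by
  induction gs with
  | nil => exact basisOperator_id.symm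
  | cons g gs ih => rw [List.foldr_cons, ih, Gate.operator, basisOperator_mul]; rfl

theorem Circuit.operator_eq [Fintype Q] (T : Circuit Q) :
    T.operator = basisOperator (run T.gates) :=
  foldr_operator T.gates

theorem Impl.exists_circuit [Fintype Q] {S : List Q} {f : (Q → Bool) → (Q → Bool)} {s d : ℕ}
    (h : Impl S f s d) :
    ∃ T : Circuit Q, T.Implements (basisOperator f) ∧ T.gateCount ≤ s ∧ T.depth ≤ d := by
  obtain ⟨ls, h1, -, h3, h4, h5⟩ := h
  refine ⟨⟨ls, h1⟩, ?_, h3, h4⟩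
  rw [Circuit.Implements, Circuit.operator_eq, ← funext h5]
  rfl

/-- The pairs are disjoint, so all equality bits are computed in parallel: one `CX` and one `X`
each. -/
theorem exists_impl_xnor : ∀ X : List (Q × Q), (pairQubits X).Nodup →
    ∃ f, Impl (pairQubits X) f (2 * X.length) 2 ∧
      ∀ x, ∀ i ∈ X, f x i.1 = (!(xor (x i.1) (x i.2))) ∧ f x i.2 = x i.2
  | [], _ => ⟨id, (Impl.refl _).mono (List.Subset.refl _) (by simp) (by simp), by simp⟩
  | (e, b) :: X, hn => by
    simp only [pairQubits_cons, List.nodup_cons, List.mem_cons, not_or] at hn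
    obtain ⟨⟨h1, h2⟩, h3, h4⟩ := hn
    obtain ⟨f, hf, hf'⟩ := exists_impl_xnor X h4
    refine ⟨_, ((((Impl.ccnot (a := b) (b := b) (t := e) h1 h1).mono (T := [e, b]) (by simp)
      le_rfl le_rfl).comp ((Impl.not e).mono (by simp) le_rfl le_rfl)).par hf ?_).mono
      (by simp) (by simp; omega) (by simp), fun x => ?_⟩
    · intro q hq hq'
      simp only [List.mem_cons, List.not_mem_nil, or_false] at hq
      rcases hq with rfl | rfl
      · exact h2 hq'
      · exact h3 hq'
    · simp only [List.mem_cons, forall_eq_or_imp]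
      refine ⟨⟨?_, ?_⟩, fun i hi => ?_⟩
      · rw [hf.of_notMem h2]
        simp [toggle_apply]
      · rw [hf.of_notMem h3]
        simp [toggle_apply, Ne.symm h1]
      · have m1 : i.1 ≠ e := fun h => h2 (mem_pairQubits.mpr ⟨i, hi, Or.inl h.symm⟩)
        have m2 : i.2 ≠ e := fun h => h2 (mem_pairQubits.mpr ⟨i, hi, Or.inr h.symm⟩)
        rw [(hf' _ i hi).1, (hf' _ i hi).2]
        simp [toggle_apply, m1, m2]

/-! ### Light cones and the lower bounds -/

/-- In one layer, a qubit depends on at most three qubits. -/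
theorem exists_dependency_layer (q : Q) : ∀ l : List (Gate Q),
    l.Pairwise (fun g h => Disjoint g.support h.support) →
    ∃ N : Finset Q, (N = {q} ∨ ∃ g ∈ l, N = g.support) ∧ q ∈ N ∧
      ∀ x y : Q → Bool, (∀ p ∈ N, x p = y p) → run l x q = run l y q
  | [], _ => ⟨{q}, by simp, by simp, fun x y h => h q (by simp)⟩
  | g :: l, hl => by
    obtain ⟨h1, h2⟩ := List.pairwise_cons.mp hl
    by_cases hq : q ∈ g.support
    · refine ⟨g.support, Or.inr ⟨g, by simp, rfl⟩, hq, fun x y h => ?_⟩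
      have e : ∀ g' ∈ l, q ∉ g'.support := fun g' hg' =>
        Finset.disjoint_left.mp (h1 g' hg') hq
      rw [run_cons, run_cons, run_of_notMem _ _ e, run_of_notMem _ _ e]
      exact g.act_congr h (h q hq)
    · obtain ⟨N, hN, hqN, h3⟩ := exists_dependency_layer q l h2
      refine ⟨N, hN.imp_right fun ⟨g', hg', e⟩ => ⟨g', by simp [hg'], e⟩, hqN, fun x y h => ?_⟩
      have hgN : ∀ p ∈ N, p ∉ g.support := by
        rcases hN with rfl | ⟨g', hg', rfl⟩
        · simpa using hq
        · exact fun p hp => Finset.disjoint_right.mp (h1 g' hg') hp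
      refine h3 (g.act x) (g.act y) fun p hp => ?_
      rw [g.act_of_notMem _ (hgN p hp), g.act_of_notMem _ (hgN p hp), h p hp]

/-- The light cone of a set of output qubits. -/
theorem exists_dependency : ∀ (ls : List (List (Gate Q))) (S : Finset Q),
    (∀ l ∈ ls, l.Pairwise fun g h => Disjoint g.support h.support) →
    ∃ N : Finset Q, N.card ≤ S.card * 3 ^ ls.length ∧
      ∀ x y : Q → Bool, (∀ p ∈ N, x p = y p) → ∀ q ∈ S, run ls.flatten x q = run ls.flatten y q
  | [], S, _ => ⟨S, by simp, fun x y h => h⟩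
  | l :: ls, S, hl => by
    obtain ⟨N, hN, h1⟩ := exists_dependency ls S fun m hm => hl m (by simp [hm])
    choose M hM hqM h2 using fun q => exists_dependency_layer q l (hl l (by simp))
    refine ⟨N.biUnion M, ?_, fun x y h q hq => ?_⟩
    · have h3 : (N.biUnion M).card ≤ N.card * 3 := by
        refine Finset.card_biUnion_le_card_mul _ _ _ fun q _ => ?_
        rcases hM q with e | ⟨g, _, e⟩
        · rw [e]; simp
        · rw [e]; exact g.card_support
      calc (N.biUnion M).card ≤ N.card * 3 := h3
        _ ≤ S.card * 3 ^ ls.length * 3 := Nat.mul_le_mul_right _ hN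
        _ = S.card * 3 ^ (l :: ls).length := by rw [List.length_cons, pow_succ, mul_assoc]
    · rw [List.flatten_cons, run_append, run_append]
      exact h1 _ _ (fun p hp => h2 p x y fun r hr => h r (Finset.mem_biUnion.mpr ⟨p, hp, hr⟩)) q hq

theorem exists_support : ∀ gs : List (Gate Q), ∃ N : Finset Q, N.card ≤ 3 * gs.length ∧
    ∀ g ∈ gs, ∀ q ∈ g.support, q ∈ N
  | [] => ⟨∅, by simp⟩
  | g :: gs => by
    obtain ⟨N, hN, h⟩ := exists_support gs
    refine ⟨g.support ∪ N, ?_, ?_⟩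
    · have := Finset.card_union_le g.support N
      have := g.card_support
      rw [List.length_cons]; omega
    · simp only [List.mem_cons, forall_eq_or_imp, Finset.mem_union]
      exact ⟨fun q hq => Or.inl hq, fun g' hg' q hq => Or.inr (h g' hg' q hq)⟩

/-- A predicate that depends on all of the qubits other than the one that it toggles requires
many gates and layers. -/
theorem Circuit.lower_bound [Fintype Q] {T : Circuit Q} {z : Q} {p : (Q → Bool) → Bool}
    (hT : T.Implements (basisOperator (toggle z p)))
    (hp : ∀ q, q ≠ z → ∃ x : Q → Bool, p (Function.update x q (!x q)) ≠ p x) :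
    Fintype.card Q ≤ 3 * T.gateCount + 1 ∧ Fintype.card Q ≤ 3 ^ T.depth + 1 := by
  have hrun : run T.gates = toggle z p := by
    rw [Circuit.Implements, Circuit.operator_eq] at hT
    exact basisOperator_injective hT
  have key : ∀ N : Finset Q, (∀ x y : Q → Bool, (∀ p ∈ N, x p = y p) → x z = y z →
      run T.gates x z = run T.gates y z) → Fintype.card Q ≤ N.card + 1 := by
    intro N hN
    -- A qubit outside `N` and different from `z` could be flipped without changing the output at
    -- `z`, against sensitivity.
    have : Finset.univ ⊆ insert z N := by
      intro q _
      by_contra hq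
      rw [Finset.mem_insert, not_or] at hq
      obtain ⟨x, hx⟩ := hp q hq.1
      refine hx ?_
      have hz : Function.update x q (!x q) z = x z := Function.update_of_ne (Ne.symm hq.1) _ _
      have := hN (Function.update x q (!x q)) x
        (fun p hp => Function.update_of_ne (ne_of_mem_of_not_mem hp hq.2) _ _) hz
      rw [hrun, toggle_self, toggle_self, hz] at this
      simpa using this
    exact (Finset.card_le_card this).trans (Finset.card_insert_le _ _)
  constructor
  · obtain ⟨N, hN, h⟩ := exists_support T.gates
    exact (key N fun x y hxy hz => run_congr T.gates (N : Set Q) h hxy hz).trans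
      (Nat.add_le_add_right hN 1)
  · obtain ⟨N, hN, h⟩ := exists_dependency T.layers {z} T.disjoint
    refine (key N fun x y hxy _ => h x y hxy z (by simp)).trans ?_
    simpa [Circuit.depth] using hN

/-! ### The controlled comparator as a toggle, its sensitivity and its circuit -/

/-- The bit that the controlled comparator adds to its output qubit. -/
def comparatorBit (k n : ℕ) (x : Fin k ⊕ ComparatorQubit n → Bool) : Bool :=
  ((List.finRange k).map Sum.inl).all x &&
    decide (Nat.ofBits (fun i => x (.inr (.a i))) < Nat.ofBits (fun i => x (.inr (.b i))))

theorem controlled_comparator (k n : ℕ) :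
    controlled k (comparator n) = basisOperator (toggle (.inr .z) (comparatorBit k n)) := by
  ext y x
  have hu : ∀ v, y = Function.update x (.inr .z) v ↔
      y ∘ Sum.inl = x ∘ Sum.inl ∧ y ∘ Sum.inr = Function.update (x ∘ Sum.inr) .z v := by
    intro v
    rw [← Sum.update_inr_comp_inr, ← Sum.update_inr_comp_inl (i := .z) (x := v) (f := x)]
    refine ⟨fun h => h ▸ ⟨rfl, rfl⟩, fun ⟨h1, h2⟩ => funext ?_⟩
    rintro (i | i)
    · exact congrFun h1 i
    · exact congrFun h2 i
  have hall : (((List.finRange k).map Sum.inl).all x) = decide (∀ i : Fin k, x (.inl i) = true) := by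
    rw [Bool.eq_iff_iff]
    simp
  simp only [controlled, basisOperator, toggle, hu, comparatorBit, hall]
  by_cases h1 : y ∘ Sum.inl = x ∘ Sum.inl
  · by_cases h2 : ∀ i : Fin k, x (.inl i) = true
    · simp [h1, h2, comparator, basisOperator]
    · have e : Function.update (x ∘ Sum.inr) ComparatorQubit.z (x (.inr .z)) = x ∘ Sum.inr :=
        Function.update_eq_self ComparatorQubit.z (x ∘ Sum.inr)
      simp [h1, h2, Matrix.one_apply, e]
  · simp [h1]

theorem ofBits_pos {n : ℕ} {f : Fin n → Bool} {i : Fin n} (h : f i = true) :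
    0 < Nat.ofBits f := by
  rw [Nat.pos_iff_ne_zero]
  intro h0
  have := Nat.testBit_ofBits_lt f i i.2
  simp [h0, h] at this

theorem card_qubits (k n : ℕ) : Fintype.card (Fin k ⊕ ComparatorQubit n) = k + 2 * n + 1 := by
  let e : ComparatorQubit n ≃ (Fin n ⊕ Fin n) ⊕ Unit :=
    { toFun := fun
        | .a i => .inl (.inl i)
        | .b i => .inl (.inr i)
        | .z => .inr ()
      invFun := fun
        | .inl (.inl i) => .a i
        | .inl (.inr i) => .b i
        | .inr () => .z
      left_inv := by rintro (i | i | _) <;> rfl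
      right_inv := by rintro ((i | i) | _) <;> rfl }
  simp only [Fintype.card_sum, Fintype.card_congr e, Fintype.card_fin, Fintype.card_unit]
  omega

theorem comparatorBit_sensitive {k n : ℕ} (hn : 0 < n) (q : Fin k ⊕ ComparatorQubit n)
    (hq : q ≠ .inr .z) :
    ∃ x, comparatorBit k n (Function.update x q (!x q)) ≠ comparatorBit k n x := by
  -- All controls are `1`, `a = 0` and `b = 2 ^ i`. Flipping a control disables the comparator,
  -- flipping `a i` gives `a = b`, and flipping `b i` gives `b = 0`; each turns the bit off.
  let X : Fin n → Fin k ⊕ ComparatorQubit n → Bool := fun i => Sum.elim (fun _ => true) fun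
    | .a _ => false
    | .b j => decide (j = i)
    | .z => false
  have h0 : Nat.ofBits (fun _ : Fin n => false) = 0 := by
    refine Nat.eq_of_testBit_eq fun i => ?_
    rcases lt_or_ge i n with h | h
    · rw [Nat.testBit_ofBits_lt _ _ h, Nat.zero_testBit]
    · rw [Nat.testBit_ofBits_ge _ _ h, Nat.zero_testBit]
  have hX : ∀ i, comparatorBit k n (X i) = true := by
    intro i
    have : 0 < Nat.ofBits fun j : Fin n => decide (j = i) := ofBits_pos (i := i) (by simp)
    simp [comparatorBit, X, h0, this]
  rcases q with i | i | i | _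
  · refine ⟨X ⟨0, hn⟩, ?_⟩
    rw [hX]
    simp only [comparatorBit, ne_eq, Bool.not_eq_true, Bool.and_eq_false_iff]
    left
    rw [List.all_eq_false]
    exact ⟨.inl i, by simp, by simp [X]⟩
  · refine ⟨X i, ?_⟩
    rw [hX]
    have e : (fun j => Function.update (X i) (.inr (.a i)) (!X i (.inr (.a i))) (.inr (.a j))) =
        fun j => Function.update (X i) (.inr (.a i)) (!X i (.inr (.a i))) (.inr (.b j)) := by
      funext j
      simp [X, Function.update_apply]
    rw [comparatorBit, e]
    simp
  · refine ⟨X i, ?_⟩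
    rw [hX]
    have e : (fun j => Function.update (X i) (.inr (.b i)) (!X i (.inr (.b i))) (.inr (.b j))) =
        fun _ => false := by
      funext j
      simp [X, Function.update_apply]
    rw [comparatorBit, e, h0]
    simp
  · exact absurd rfl hq

/-- The controlled selection is conjugated by the computation of the equality bits. The shifts `k +
1` and `n + 2` supply the control and the two items that `impl_toggle_all_and_sel` splits off. -/
theorem exists_circuit_comparator {k n K : ℕ} (hk : k + 2 ≤ 2 ^ K) (hn : n + 1 ≤ 2 ^ K) :
    ∃ T : Circuit (Fin (k + 1) ⊕ ComparatorQubit (n + 2)),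
      T.Implements (controlled (k + 1) (comparator (n + 2))) ∧
      T.gateCount ≤ 384 * k + 52 * n + 1384 ∧ T.depth ≤ 3264 * K + 7836 := by
  let A : Fin (n + 2) → Fin (k + 1) ⊕ ComparatorQubit (n + 2) := fun i => .inr (.a i)
  let B : Fin (n + 2) → Fin (k + 1) ⊕ ComparatorQubit (n + 2) := fun i => .inr (.b i)
  obtain ⟨Y, hY⟩ : ∃ Y : List (Fin (k + 1) ⊕ ComparatorQubit (n + 2)),
    (List.finRange (k + 1)).map Sum.inl = Y := ⟨_, rfl⟩
  obtain ⟨X, hX⟩ : ∃ X, (List.finRange (n + 2)).reverse.map (fun i => (A i, B i)) = X := ⟨_, rfl⟩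
  have lY : Y.length = k + 1 := by simp [← hY]
  have lX : X.length = n + 2 := by simp [← hX]
  have nX : (pairQubits X).Nodup := by
    rw [← hX]
    refine nodup_pairQubits_map ?_ ?_ ?_ (List.nodup_reverse.mpr (List.nodup_finRange _))
    · intro i j h; simpa [A] using h
    · intro i j h; simpa [B] using h
    · intro i j h; simp [A, B] at h
  have mX : ∀ q ∈ pairQubits X, ∃ i, q = A i ∨ q = B i := by
    intro q hq
    rw [← hX] at hq
    obtain ⟨p, hp, h⟩ := mem_pairQubits.mp hq
    obtain ⟨i, -, rfl⟩ := List.mem_map.mp hp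
    exact ⟨i, h⟩
  have mY : ∀ q ∈ Y, ∃ i, q = .inl i := by
    intro q hq
    rw [← hY] at hq
    obtain ⟨i, -, rfl⟩ := List.mem_map.mp hq
    exact ⟨i, rfl⟩
  have zX : .inr .z ∉ pairQubits X := by
    intro h
    obtain ⟨i, h | h⟩ := mX _ h <;> simp [A, B] at h
  have zY : .inr .z ∉ Y := by
    intro h
    obtain ⟨i, h⟩ := mY _ h
    simp at h
  have hXY : ∀ q ∈ Y, q ∉ pairQubits X := by
    intro q hq h
    obtain ⟨i, rfl⟩ := mY _ hq
    obtain ⟨j, h | h⟩ := mX _ h <;> simp [A, B] at h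
  have hn' : (.inr .z :: Y ++ pairQubits X).Nodup := by
    rw [List.cons_append, List.nodup_cons, List.mem_append, List.nodup_append, ← hY]
    rw [← hY] at zY hXY
    exact ⟨by tauto, (List.nodup_finRange _).map Sum.inl_injective, nX,
      fun a ha b hb e => hXY a ha (e ▸ hb)⟩
  obtain ⟨f, hf, hf'⟩ := exists_impl_xnor X nX
  have main : Impl (.inr .z :: Y ++ pairQubits X) (toggle (.inr .z) fun x => Y.all x && sel X false x)
      (384 * k + 48 * n + 1376) (3264 * K + 7832) := by
    clear hf hf' hX hY mX mY zX zY hXY nX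
    rcases Y with _ | ⟨c, Y⟩
    · simp at lY
    rcases X with _ | ⟨⟨e, b⟩, _ | ⟨⟨e', b'⟩, X⟩⟩
    · simp at lX
    · simp at lX
    simp only [List.length_cons] at lY lX
    exact (impl_toggle_all_and_sel (K + 1) (by rw [pow_succ]; omega) (by rw [pow_succ]; omega)
      hn').mono (List.Subset.refl _) (by omega) (by omega)
  obtain ⟨T, h1, h2, h3⟩ := (hf.conj_toggle zX (fun _ hq => List.mem_append_right _ hq) main).exists_circuit
  refine ⟨T, ?_, by omega, h3.trans (by linarith)⟩
  rw [controlled_comparator]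
  convert h1 using 3
  funext x
  have hY' : Y.all (f x) = Y.all x := all_congr fun q hq => hf.of_notMem (hXY q hq) x
  have hmem : ∀ i, (A i, B i) ∈ X := fun i => by
    rw [← hX]; exact List.mem_map.mpr ⟨i, by simp, rfl⟩
  rw [hY', ← hX, sel_reverse_finRange (f x) false (n + 2) (fun i => x (.inr (.a i)))
    (fun i => x (.inr (.b i))) A B (fun i => (hf' x _ (hmem i)).1) (fun i => (hf' x _ (hmem i)).2),
    comparatorBit, hY]
  congr 1
  split_ifs with h
  · simp [h]
  · rfl


end

end QuantumCircuit


/-! ### The absolute constants -/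

open QuantumCircuit in
theorem mainTheorem8 :
    ∃ c C : ℝ, 0 < c ∧ 0 < C ∧ ∀ k n : ℕ, 1 ≤ k → 1 < n →
      (∃ T : Circuit (Fin k ⊕ ComparatorQubit n),
        T.Implements (controlled k (comparator n)) ∧
        (T.gateCount : ℝ) ≤ C * ((k : ℝ) + n) ∧
        (T.depth : ℝ) ≤ C * Real.log ((k : ℝ) * n)) ∧
      (∀ T : Circuit (Fin k ⊕ ComparatorQubit n),
        T.Implements (controlled k (comparator n)) →
        c * ((k : ℝ) + n) ≤ (T.gateCount : ℝ) ∧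
        c * Real.log ((k : ℝ) * n) ≤ (T.depth : ℝ)) := by
  refine ⟨1 / 4, 40000, by norm_num, by norm_num, fun k n hk hn => ⟨?_, fun T hT => ?_⟩⟩
  · obtain ⟨k, rfl⟩ : ∃ m, k = m + 1 := ⟨k - 1, by omega⟩
    obtain ⟨n, rfl⟩ : ∃ m, n = m + 2 := ⟨n - 2, by omega⟩
    have hm : (k + 1) * (n + 2) ≠ 0 := by positivity
    obtain ⟨L, hL⟩ : ∃ L, Nat.log 2 ((k + 1) * (n + 2)) = L := ⟨_, rfl⟩
    have h1 : (k + 1) * (n + 2) < 2 ^ (L + 1) := hL ▸ Nat.lt_pow_succ_log_self one_lt_two _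
    have h2 : 2 ^ L ≤ (k + 1) * (n + 2) := hL ▸ Nat.pow_log_le_self 2 hm
    -- Since `2 ^ (L + 1)` exceeds the product of the two sizes, it bounds both at once.
    obtain ⟨T, hT, hs, hd⟩ := exists_circuit_comparator (k := k) (n := n) (K := L + 1)
      (by nlinarith) (by nlinarith)
    refine ⟨T, hT, ?_, ?_⟩
    · have : (T.gateCount : ℝ) ≤ 384 * k + 52 * n + 1384 := by exact_mod_cast hs
      push_cast
      have : (0 : ℝ) ≤ k := k.cast_nonneg
      have : (0 : ℝ) ≤ n := n.cast_nonneg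
      linarith
    · have h3 : (T.depth : ℝ) ≤ 3264 * (L + 1) + 7836 := by exact_mod_cast hd
      have h4 : (L : ℝ) * Real.log 2 ≤ Real.log (((k + 1 : ℕ) : ℝ) * (n + 2 : ℕ)) := by
        rw [← Real.log_pow]
        exact Real.log_le_log (by positivity) (by exact_mod_cast h2)
      have h5 : Real.log 2 ≤ Real.log (((k + 1 : ℕ) : ℝ) * (n + 2 : ℕ)) :=
        Real.log_le_log (by norm_num) (by
          have : 2 ≤ (k + 1) * (n + 2) := by nlinarith
          exact_mod_cast this)
      have h6 := Real.log_two_gt_d9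
      have : (0 : ℝ) ≤ L := L.cast_nonneg
      nlinarith
  · rw [controlled_comparator] at hT
    obtain ⟨h1, h2⟩ := T.lower_bound hT fun q hq => comparatorBit_sensitive (by omega) q hq
    rw [card_qubits] at h1 h2
    constructor
    · have : ((k + 2 * n + 1 : ℕ) : ℝ) ≤ ((3 * T.gateCount + 1 : ℕ) : ℝ) := by exact_mod_cast h1
      push_cast at this
      have : (0 : ℝ) ≤ k := k.cast_nonneg
      have : (0 : ℝ) ≤ n := n.cast_nonneg
      linarith
    -- Squaring the light-cone bound turns a sum into a product, costing a factor `2` in the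
    -- logarithm; with `log 3 ≤ 2` this yields `c = 1 / 4`.
    · have h3 : k * n ≤ (3 ^ T.depth) ^ 2 := by
        have : k + 2 * n ≤ 3 ^ T.depth := by omega
        calc k * n ≤ (k + 2 * n) ^ 2 := by nlinarith
          _ ≤ _ := Nat.pow_le_pow_left this 2
      have h4 : Real.log ((k : ℝ) * n) ≤ 2 * (T.depth * Real.log 3) := by
        have h5 : ((k : ℝ) * n) ≤ ((3 : ℝ) ^ T.depth) ^ 2 := by exact_mod_cast h3
        have h6 := Real.log_le_log (by positivity) h5
        rwa [Real.log_pow, Real.log_pow, Nat.cast_ofNat] at h6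
      have h7 : Real.log 3 ≤ 2 := by
        have := Real.log_le_sub_one_of_pos (show (0 : ℝ) < 3 by norm_num)
        linarith
      have : (0 : ℝ) ≤ T.depth := T.depth.cast_nonneg
      nlinarith
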